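/- Let $\mathbf S=\{0,1\}^*$, let $\|x\|$ be the length of $x\in\mathbf S$, and $\|r\|=\lceil|\log_2 r|\rceil$ for real $r>0$. A \emph{prefix algorithm} is a partial computable functional $U$ taking a program $p\in\mathbf S$ and an auxiliary input $y$ (a finite string or an infinite binary sequence) to a string $U_y(p)$, such that, for all $y,p,x$, $U_y(p)=x$ iff $U_y(p0)=U_y(p1)=x$; an empty $y$ is omitted. Let $\mathbf K(x|y)=\mathbf K_U(x|y)=\min\{\|p\|:U_y(p)=x\}$. $U$ is \emph{universal} if for every prefix algorithm $V$ there is a constant $c$ with $\mathbf K_U(x|y)\le\mathbf K_V(x|y)+c$ for all $x,y$. A string $p$ is \emph{total} if for some $k$, $U(ps)$ halts for all $s\in\{0,1\}^k$; $U$ is \emph{left-total} if $p0$ is total whenever $U(p1s)$ halts for some $s$. Fix a universal left-total prefix algorithm $U$. Let $\mathcal H$ be its halting sequence, $\mathcal H(i)=1$ if $i$ is the number (in a standard computable injective numbering) of a string on which $U$ halts, and $\mathcal H(i)=0$ otherwise, and let $\mathbf I(a:\mathcal H)=\mathbf K(a)-\mathbf K(a|\mathcal H)$. For a string $v$ whose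 output $U(v)$ is (the code of) a finitely supported probability distribution $Q$ on $\mathbf S$ with rational values, and a string $a$ with $Q(\{a\})>0$, let $\mathbf d(a|Q,v)=\lfloor|\log_2 Q(\{a\})|\rfloor-\mathbf K(a|v)$. For $f:\mathbb Z\to\mathbb R$ let $$\chi_f(a)=\inf_{v,\;Q=U(v)}\bigl(\|v\|+f(\mathbf d(a|Q,v))\bigr),$$ the infimum being over all such $v,Q$ with $Q(\{a\})>0$ (it is a minimum whenever $f$ is bounded below). \textbf{Proposition.} Let $f(n)\in O(n)$ as $n\to+\infty$. Then there is a constant $C$, depending only on $U$ and $f$, such that for every string $a$ $$\mathbf I(a:\mathcal H)>\chi_f(a)-C\,\bigl(\|\max(\chi_f(a),0)+1\|+1\bigr).$$ -/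

import Mathlib

open Filter Asymptotics

namespace AlgInfo

/-- Binary strings. -/
abbrev Str := List Bool

/-- Auxiliary inputs: a finite string or an infinite binary sequence. -/
inductive Aux
  | str (s : Str)
  | seq (z : ℕ → Bool)

/-- The `i`-th cell of the auxiliary tape; `none` is the blank after the end of a finite string. -/
def Aux.read : Aux → ℕ → Option Bool
  | .str s, i => s[i]?
  | .seq z, i => some (z i)

/-- The first `n` cells of the auxiliary tape. -/
def Aux.take (y : Aux) (n : ℕ) : List (Option Bool) := (List.range n).map y.read

/-- The absent (empty) auxiliary input. -/
def Aux.empty : Aux := .str []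

/-- A partial map taking an auxiliary input `y` and a program `p` to a string `U y p`. -/
abbrev Machine := Aux → Str → Part Str

/-- `U` is an algorithm (a partial computable functional of the auxiliary input): its graph is
enumerated by one enumerable set of triples `(σ, p, x)`, where `σ` is the finite portion of the
auxiliary tape inspected by the computation that outputs `x` on the program `p`. -/
def Machine.IsAlgorithm (U : Machine) : Prop :=
  ∃ W : List (Option Bool) × Str × Str → Prop, REPred W ∧
    ∀ (y : Aux) (p x : Str), x ∈ U y p ↔ ∃ n : ℕ, W (y.take n, p, x)

/-- Prefix algorithms: `U(p) = x` iff `U(p0) = U(p1) = x`, for each auxiliary input. -/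
structure Machine.IsPrefixAlgorithm (U : Machine) : Prop where
  isAlgorithm : U.IsAlgorithm
  mem_iff : ∀ (y : Aux) (p x : Str),
    x ∈ U y p ↔ x ∈ U y (p ++ [false]) ∧ x ∈ U y (p ++ [true])

/-- Complexity `K(x|y)`: the least length of a program of `x` (`⊤` if there is none). -/
noncomputable def Machine.K (U : Machine) (x : Str) (y : Aux) : ℕ∞ :=
  ⨅ (p : Str) (_ : x ∈ U y p), (p.length : ℕ∞)

/-- `U` minimizes `K` up to an additive constant among the prefix algorithms. -/
def Machine.IsUniversal (U : Machine) : Prop :=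
  U.IsPrefixAlgorithm ∧
    ∀ V : Machine, V.IsPrefixAlgorithm → ∃ c : ℕ, ∀ (x : Str) (y : Aux), U.K x y ≤ V.K x y + c

/-- `p` is total if, for some `k`, `U` halts on `ps` for all `k`-bit `s`. -/
def Machine.Total (U : Machine) (p : Str) : Prop :=
  ∃ k : ℕ, ∀ s : Str, s.length = k → (U Aux.empty (p ++ s)).Dom

/-- Left-total machines: if `U(p1s)` halts, then `p0` is total. -/
def Machine.IsLeftTotal (U : Machine) : Prop :=
  ∀ p s : Str, (U Aux.empty (p ++ [true] ++ s)).Dom → U.Total (p ++ [false])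

/-- Complexities are finite for a universal `U`. -/
theorem Machine.IsUniversal.K_ne_top {U : Machine} (hU : U.IsUniversal) (x : Str) (y : Aux) :
    U.K x y ≠ ⊤ := by
  have hV : Machine.IsPrefixAlgorithm (fun _ _ => Part.some x) := by
    refine ⟨⟨fun t => t.2.2 = x, ?_, fun y p z => ?_⟩, fun y p z => by simp⟩
    · have : PrimrecPred fun t : List (Option Bool) × Str × Str => t.2.2 = x :=
        Primrec.eq.comp (Primrec.snd.comp Primrec.snd) (Primrec.const x)
      exact this.computablePred.to_re
    · simp
  obtain ⟨c, hc⟩ := hU.2 _ hV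
  have h0 : Machine.K (fun _ _ => Part.some x) x y ≤ 0 := by
    refine (iInf₂_le ([] : Str) (by simp)).trans ?_
    simp
  exact ne_top_of_le_ne_top (ENat.natCast_ne_top c)
    ((hc x y).trans (by simpa using add_le_add_left h0 (c : ℕ∞)))

open Classical in
/-- The halting sequence of `U`: `halting U i = 1` iff `i` is the number of a string on which `U`
halts (strings are numbered by their standard encoding as natural numbers). -/
noncomputable def Machine.halting (U : Machine) (i : ℕ) : Bool :=
  decide (∃ p : Str, Encodable.encode p = i ∧ (U Aux.empty p).Dom)

/-- Information about the halting sequence: `I(a : H) = K(a) - K(a|H)`. -/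
noncomputable def Machine.infoHalting (U : Machine) (a : Str) : ℤ :=
  ((U.K a Aux.empty).toNat : ℤ) - ((U.K a (Aux.seq U.halting)).toNat : ℤ)

/-- Finitely supported nonnegative rational weights on strings. -/
abbrev Weights := Str →₀ ℚ≥0

/-- The weights described by a finite list of triples `(x, m, n)`: each of them contributes
`m / (n + 1)` to the weight of `x`. -/
noncomputable def weightsOf (L : List (Str × ℕ × ℕ)) : Weights :=
  (L.map fun t => Finsupp.single t.1 ((t.2.1 : ℚ≥0) / ((t.2.2 : ℚ≥0) + 1))).sum

/-- `U(v) = Q`: on the program `v`, without auxiliary input, `U` outputs the binary notation of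
the code number of a list describing `Q`. -/
def Machine.Outputs (U : Machine) (v : Str) (Q : Weights) : Prop :=
  ∃ L : List (Str × ℕ × ℕ), Nat.bits (Encodable.encode L) ∈ U Aux.empty v ∧ weightsOf L = Q

/-- `Q` is a probability distribution: its total weight is `1`. -/
def Weights.IsProb (Q : Weights) : Prop := Q.sum (fun _ w => w) = 1

/-- Non-randomness `d(a|Q,v) = ⌊|log Q({a})|⌋ - K(a|v)`, where `Q({a}) > 0`. -/
noncomputable def Machine.nonrandomness (U : Machine) (a : Str) (Q : Weights) (v : Str) : ℤ :=
  ⌊|Real.logb 2 ((Q a : ℚ≥0) : ℝ)|⌋ - ((U.K a (Aux.str v)).toNat : ℤ)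

/-- The slice `χ_f(a)` of the structure function: the minimum of `‖v‖ + f(d(a|Q,v))` over all
`v` such that `Q = U(v)` is a probability distribution for which `d(a|Q,v)` is finite. -/
noncomputable def Machine.chi (U : Machine) (f : ℤ → ℝ) (a : Str) : EReal :=
  ⨅ (v : Str) (Q : Weights) (_ : U.Outputs v Q ∧ Q.IsProb ∧ 0 < Q a),
    (((v.length : ℝ) + f (U.nonrandomness a Q v) : ℝ) : EReal)

/-- `‖r‖ = ⌈|log r|⌉` for positive real `r`. -/
noncomputable def lnorm (r : ℝ) : ℕ := ⌈|Real.logb 2 r|⌉₊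

end AlgInfo

/-! Take a shortest program `p = v ++ w` of `a`, where `v` is its shortest total prefix, and let `n`
be the length of `v`. Both sides of the inequality are compared with `n`, up to `O(log n)`.

Information about the halting sequence is at least `n - O(log n)`. In a left-total machine there is
at most one minimal total string of each length (`Machine.MinTotal.unique`), and the halting
sequence decides totality of strings of bounded length. So, given that sequence, `n` and `w` suffice
to recover `a` (`Machine.IsUniversal.exists_K_halting_le`), while `K(a) = n + ‖w‖`.

The structure function is at most `n + O(log n)`. Totality of `v` gives a `k` such that `U (v ++ s)`
halts for all `k`-bit `s`; a uniformly random `s` yields a distribution computable from `v`. It is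
pruned so that a nonempty `a` gets exactly the weight of a single cylinder `u`, with `‖u‖ ≤ ‖w‖`
(`exists_cylinder`). Let `v'` be a shortest program of the pruned list; its length is at most `n +
O(log n)`. Since `u` describes `a` relative to `v'` (`Machine.IsUniversal.exists_K_str_le`), the
non-randomness is bounded below by a constant; since `n + ‖w‖ = K(a)` is at most `‖v'‖ + K(a|v') +
O(log n)`, it is at most `O(log n)`. The lower bound is essential because `f` is controlled only
towards `+∞`; together the bounds give `f(d) = O(log n)`.

It remains to replace `log n` by the logarithm of the structure function. If the latter is at least
`n / 2`, this is immediate; if it is smaller, the bound `n - O(log n)` on the information already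
exceeds it up to a constant. -/

namespace AlgInfo

/-! ### Semidecidable predicates -/

/-- A semidecidable predicate is the projection of a primitive recursive relation. -/
theorem _root_.REPred.exists_primrecRel {α : Type*} [Primcodable α] {p : α → Prop}
    (h : REPred p) : ∃ R : α → ℕ → Prop, PrimrecRel R ∧ ∀ a, p a ↔ ∃ t, R a t := by
  obtain ⟨c, hc⟩ := Nat.Partrec.Code.exists_code.1 h
  refine ⟨fun a t => (Nat.Partrec.Code.evaln t c (Encodable.encode a)).isSome = true, ?_, ?_⟩
  · refine Primrec.eq.comp (Primrec.option_isSome.comp ?_) (Primrec.const true)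
    exact Nat.Partrec.Code.primrec_evaln.comp
      ((Primrec.snd.pair (Primrec.const c)).pair (Primrec.encode.comp Primrec.fst))
  · intro a
    have h1 : p a ↔ ∃ x, x ∈ Nat.Partrec.Code.eval c (Encodable.encode a) := by
      rw [hc]
      simp
    rw [h1]
    simp only [Nat.Partrec.Code.evaln_complete, Option.isSome_iff_exists, Option.mem_def]
    exact exists_comm

/-- The projection of a primitive recursive relation is semidecidable. -/
theorem _root_.PrimrecRel.rePred_exists {α β : Type*} [Primcodable α] [Primcodable β]
    {R : α → β → Prop} (h : PrimrecRel R) : REPred fun a => ∃ b, R a b := by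
  classical
  have hf : Primrec₂ fun (a : α) (n : ℕ) =>
      (Encodable.decode (α := β) n).bind fun b => if R a b then some () else none := by
    refine Primrec.option_bind (Primrec.decode.comp Primrec.snd) ?_
    refine Primrec.ite ?_ (Primrec.const _) (Primrec.const _)
    exact h.comp (Primrec.fst.comp Primrec.fst) Primrec.snd
  refine (Partrec.dom_re (Partrec.rfindOpt hf.to_comp)).of_eq fun a => ?_
  rw [Nat.rfindOpt_dom]
  constructor
  · rintro ⟨n, x, hx⟩
    simp only [Option.mem_def, Option.bind_eq_some_iff] at hx
    obtain ⟨b, -, hb⟩ := hx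
    by_cases hab : R a b
    · exact ⟨b, hab⟩
    · simp [hab] at hb
  · rintro ⟨b, hb⟩
    exact ⟨Encodable.encode b, (), by simp [hb]⟩

theorem _root_.PrimrecRel.forall_mem {α β : Type*} [Primcodable α] [Primcodable β]
    {R : α → β → Prop} (h : PrimrecRel R) {l : α → List β} (hl : Primrec l) :
    PrimrecPred fun a => ∀ b ∈ l a, R a b :=
  (PrimrecRel.forall_mem_list h.swap).comp hl Primrec.id

theorem _root_.PrimrecRel.exists_mem {α β : Type*} [Primcodable α] [Primcodable β]
    {R : α → β → Prop} (h : PrimrecRel R) {l : α → List β} (hl : Primrec l) :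
    PrimrecPred fun a => ∃ b ∈ l a, R a b :=
  (PrimrecRel.exists_mem_list h.swap).comp hl Primrec.id

theorem _root_.PrimrecPred.imp {α : Type*} [Primcodable α] {p q : α → Prop}
    (hp : PrimrecPred p) (hq : PrimrecPred q) : PrimrecPred fun a => p a → q a :=
  (hp.not.or hq).of_eq fun a => by tauto

/-! ### Strings of a given length -/

/-- All binary strings of length `k`. -/
def allStr : ℕ → List Str
  | 0 => [[]]
  | k + 1 => (allStr k).map (List.cons false) ++ (allStr k).map (List.cons true)

@[simp] theorem mem_allStr {k : ℕ} {s : Str} : s ∈ allStr k ↔ s.length = k := by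
  induction k generalizing s with
  | zero => simp [allStr]
  | succ k ih =>
    cases s with
    | nil => simp [allStr]
    | cons b s => cases b <;> simp [allStr, ih]

@[simp] theorem length_allStr (k : ℕ) : (allStr k).length = 2 ^ k := by
  induction k with
  | zero => rfl
  | succ k ih => simp [allStr, ih, pow_succ, mul_two]

theorem nodup_allStr (k : ℕ) : (allStr k).Nodup := by
  induction k with
  | zero => simp [allStr]
  | succ k ih =>
    refine List.Nodup.append (ih.map List.cons_injective) (ih.map List.cons_injective) ?_
    intro s h1 h2
    simp only [List.mem_map] at h1 h2
    obtain ⟨x, -, rfl⟩ := h1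
    obtain ⟨y, -, h⟩ := h2
    simp at h

theorem primrec_allStr : Primrec allStr := by
  refine (Primrec.nat_rec₁ (f := fun (_ : ℕ) (l : List Str) =>
    l.map (List.cons false) ++ l.map (List.cons true)) [[]] ?_).of_eq fun k => ?_
  · refine Primrec.list_append.comp ?_ ?_ <;>
    exact Primrec.list_map Primrec.snd
      (Primrec.list_cons.comp (Primrec.const _) Primrec.snd)
  · induction k with
    | zero => rfl
    | succ k ih => simp only [allStr, ← ih]

/-- All binary strings of length at most `k`, by increasing length. -/
def strUpTo (k : ℕ) : List Str := (List.range (k + 1)).flatMap allStr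

@[simp] theorem mem_strUpTo {k : ℕ} {s : Str} : s ∈ strUpTo k ↔ s.length ≤ k := by
  simp [strUpTo]

theorem primrec_strUpTo : Primrec strUpTo :=
  Primrec.list_flatMap (Primrec.list_range.comp Primrec.succ)
    (primrec_allStr.comp Primrec.snd)

/-- Ordering by length makes the head of any filtered sublist a shortest string with the filtered
property. -/
theorem pairwise_strUpTo (k : ℕ) :
    (strUpTo k).Pairwise fun s t => s.length ≤ t.length := by
  rw [strUpTo, List.pairwise_flatMap]
  refine ⟨fun i _ => ?_, ?_⟩
  · refine List.Pairwise.imp_of_mem (R := fun _ _ => True) ?_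
      (List.pairwise_of_forall fun _ _ => trivial)
    intro s t hs ht _
    rw [mem_allStr] at hs ht
    omega
  · refine List.Pairwise.imp ?_ List.pairwise_lt_range
    intro i j hij s hs t ht
    rw [mem_allStr] at hs ht
    omega

/-! ### Self-delimiting codes of numbers -/

theorem primrec_bits : Primrec Nat.bits := by
  -- The history `l` holds the values at all smaller arguments, so its length is the current number;
  -- the bits are its parity followed by the entry at its half.
  have hg : Primrec₂ fun (_ : Unit) (l : List (List Bool)) =>
      some (if l.length = 0 then [] else
        (Nat.bodd l.length) :: ((l[Nat.div2 l.length]?).getD [])) := by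
    have hlen : Primrec fun x : Unit × List (List Bool) => x.2.length :=
      Primrec.list_length.comp Primrec.snd
    refine Primrec.option_some.comp (Primrec.ite ?_ (Primrec.const _) ?_)
    · exact Primrec.eq.comp hlen (Primrec.const 0)
    · refine Primrec.list_cons.comp (Primrec.nat_bodd.comp hlen) ?_
      exact Primrec.option_getD.comp (Primrec.list_getElem?.comp Primrec.snd
        (Primrec.nat_div2.comp hlen)) (Primrec.const _)
  have := Primrec.nat_strong_rec (fun (_ : Unit) n => Nat.bits n) hg ?_
  · exact this.comp (Primrec.const ()) Primrec.id
  · intro _ n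
    simp only [List.length_map, List.length_range, Option.some.injEq]
    rcases Nat.eq_zero_or_pos n with rfl | hn
    · simp
    · rw [if_neg hn.ne']
      have h2 : Nat.div2 n < n := by
        rw [Nat.div2_val]; omega
      rw [List.getElem?_map, List.getElem?_range h2]
      simp only [Option.map_some, Option.getD_some]
      conv_rhs => rw [← Nat.bit_bodd_div2 n]
      rw [Nat.bits_append_bit]
      intro h
      rw [Nat.div2_val] at h
      have : n = 1 := by omega
      subst this
      rfl

/-- The self-delimiting code of a list of bits. -/
def delim (l : Str) : Str := l.flatMap (fun b => [true, b]) ++ [false]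

/-- Every data bit is preceded by `true` and the end is marked by `false`, so a decoder knows where
the code stops. -/
theorem delim_append_inj {l l' r r' : Str} (h : delim l ++ r = delim l' ++ r') :
    l = l' ∧ r = r' := by
  induction l generalizing l' with
  | nil => cases l' <;> simp_all [delim]
  | cons b l ih =>
    cases l' with
    | nil => simp [delim] at h
    | cons b' l' =>
      have h' : b = b' ∧ delim l ++ r = delim l' ++ r' := by simpa [delim] using h
      obtain ⟨rfl, h''⟩ := h'
      obtain ⟨rfl, rfl⟩ := ih h''
      simp

theorem bits_injective : Function.Injective Nat.bits := by
  refine Function.LeftInverse.injective (g := List.foldr Nat.bit 0) fun n => ?_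
  induction n using Nat.binaryRec' with
  | zero => simp
  | bit b n h ih => rw [Nat.bits_append_bit _ _ h, List.foldr_cons, ih]

/-- The self-delimiting code of a natural number. -/
def code (n : ℕ) : Str := delim (Nat.bits n)

theorem code_append_inj {m n : ℕ} {r r' : Str} (h : code m ++ r = code n ++ r') :
    m = n ∧ r = r' := by
  obtain ⟨h1, h2⟩ := delim_append_inj h
  exact ⟨bits_injective h1, h2⟩

theorem length_code (n : ℕ) : (code n).length = 2 * Nat.size n + 1 := by
  simp [code, delim, Nat.size_eq_bits_len, List.length_flatMap, mul_comm]

theorem primrec_code : Primrec code := by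
  refine Primrec.list_append.comp (Primrec.list_flatMap primrec_bits ?_) (Primrec.const _)
  exact Primrec.list_cons.comp (Primrec.const true)
    (Primrec.list_cons.comp Primrec.snd (Primrec.const []))

/-! ### Auxiliary inputs and algorithms -/

@[simp] theorem Aux.length_take (y : Aux) (n : ℕ) : (y.take n).length = n := by
  simp [Aux.take]

theorem Aux.take_take (y : Aux) {m n : ℕ} (h : m ≤ n) : (y.take n).take m = y.take m := by
  simp only [Aux.take, ← List.map_take, List.take_range, min_eq_left h]

theorem Aux.eq_take_of_append {y : Aux} {n : ℕ} {σ ρ : List (Option Bool)}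
    (h : σ ++ ρ = y.take n) : σ = y.take σ.length := by
  have hn : σ.length ≤ n := by
    rw [← y.length_take n, ← h]
    simp
  rw [← y.take_take hn, ← h]
  simp

theorem Aux.take_append_drop (y : Aux) {m n : ℕ} (h : m ≤ n) :
    y.take m ++ (y.take n).drop m = y.take n := by
  rw [← y.take_take h, List.take_append_drop]

theorem Aux.take_empty (n : ℕ) : Aux.empty.take n = List.replicate n none := by
  simp [Aux.take, Aux.empty, Aux.read, List.eq_replicate_iff]

theorem primrec_take_empty : Primrec Aux.empty.take := by
  refine (Primrec.list_map Primrec.list_range (Primrec.const none).to₂).of_eq fun n => ?_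
  rw [Aux.take_empty]
  simp

/-- The tape carrying a finite string, up to and including the first blank. -/
def closedTape (s : Str) : List (Option Bool) := s.map some ++ [none]

theorem primrec_closedTape : Primrec closedTape :=
  Primrec.list_append.comp (Primrec.list_map Primrec.id (Primrec.option_some.comp Primrec.snd))
    (Primrec.const _)

theorem take_str (s : Str) (n : ℕ) :
    (Aux.str s).take n = (s.map some).take n ++ List.replicate (n - s.length) none := by
  refine List.ext_getElem? fun i => ?_
  by_cases hi : i < n
  · rw [Aux.take, List.getElem?_map, List.getElem?_range hi, Option.map_some,
      List.getElem?_append]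
    by_cases hs : i < s.length
    · simp [hi, hs, Aux.read]
    · simp only [Aux.read, List.length_take, List.length_map, lt_min_iff, hi, hs, and_false,
        if_false]
      rw [List.getElem?_replicate, if_pos (by omega)]
      simp at hs ⊢
      omega
  · rw [List.getElem?_eq_none (by simp; omega), List.getElem?_eq_none (by simp; omega)]

theorem primrec_take_str : Primrec₂ fun (s : Str) n => (Aux.str s).take n := by
  have h : Primrec₂ fun (s : Str) n => (List.range n).map fun i => s[i]? :=
    Primrec.list_map (Primrec.list_range.comp Primrec.snd)
      (Primrec.list_getElem?.comp (Primrec.fst.comp Primrec.fst) Primrec.snd)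
  exact h

theorem take_str_succ (s : Str) : (Aux.str s).take (s.length + 1) = closedTape s := by
  simp [take_str, closedTape, List.take_of_length_le]

/-- The final blank makes closed tapes prefix-free. Hence a description that reads a closed tape
knows the whole finite auxiliary string. -/
theorem closedTape_eq_of_take {y : Aux} {m n : ℕ} {s t : Str}
    (hs : y.take m = closedTape s) (ht : y.take n = closedTape t) : s = t := by
  have key : ∀ {s t : Str} {ρ : List (Option Bool)},
      closedTape s ++ ρ = closedTape t → s = t := by
    intro s
    induction s with
    | nil => intro t ρ h; cases t <;> simp_all [closedTape]
    | cons b s ih =>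
      intro t ρ h
      cases t with
      | nil => simp [closedTape] at h
      | cons b' t =>
        have h' : b = b' ∧ closedTape s ++ ρ = closedTape t := by simpa [closedTape] using h
        rw [h'.1, ih h'.2]
  rcases le_total m n with h | h
  · exact key (ρ := (y.take n).drop m) (by rw [← hs, ← ht, y.take_append_drop h])
  · exact (key (ρ := (y.take m).drop n) (by rw [← hs, ← ht, y.take_append_drop h])).symm

variable {U : Machine}

theorem Machine.K_le_length {y : Aux} {p x : Str} (h : x ∈ U y p) : U.K x y ≤ p.length :=
  iInf₂_le p h

theorem Machine.IsPrefixAlgorithm.mem_append (hU : U.IsPrefixAlgorithm) {y : Aux} {p x : Str}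
    (h : x ∈ U y p) (s : Str) : x ∈ U y (p ++ s) := by
  induction s generalizing p with
  | nil => simpa using h
  | cons b s ih =>
    have h2 := (hU.mem_iff y p x).1 h
    have : x ∈ U y (p ++ [b]) := by
      cases b
      · exact h2.1
      · exact h2.2
    simpa using ih this

/-- Approximations by stages to the computations of `U` without auxiliary input. -/
structure Machine.IsStage (U : Machine) (st : ℕ → Str → Option Str) : Prop where
  primrec : Primrec₂ st
  mono : ∀ {t t' : ℕ} {p x : Str}, t ≤ t' → st t p = some x → st t' p = some x
  mem_iff : ∀ {p x : Str}, x ∈ U Aux.empty p ↔ ∃ t, st t p = some x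

theorem Machine.IsAlgorithm.exists_isStage (hU : U.IsAlgorithm) : ∃ st, U.IsStage st := by
  classical
  obtain ⟨W, hW, hUW⟩ := hU
  obtain ⟨R, hR, hWR⟩ := hW.exists_primrecRel
  let f : Str → ℕ → Option Str := fun p e =>
    (Encodable.decode (α := ℕ × Str × ℕ) e).bind fun d =>
      if R (Aux.empty.take d.1, p, d.2.1) d.2.2 then some d.2.1 else none
  have hf : Primrec₂ f := by
    refine Primrec.option_bind (Primrec.decode.comp Primrec.snd) ?_
    refine Primrec.ite ?_ ?_ (Primrec.const _)
    · refine hR.comp (Primrec.pair ?_ (Primrec.pair (Primrec.fst.comp Primrec.fst) ?_)) ?_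
      · exact primrec_take_empty.comp (Primrec.fst.comp Primrec.snd)
      · exact Primrec.fst.comp (Primrec.snd.comp Primrec.snd)
      · exact Primrec.snd.comp (Primrec.snd.comp Primrec.snd)
    · exact Primrec.option_some.comp (Primrec.fst.comp (Primrec.snd.comp Primrec.snd))
  have hfU : ∀ {p e x}, f p e = some x → x ∈ U Aux.empty p := by
    intro p e x h
    simp only [f, Option.bind_eq_some_iff] at h
    obtain ⟨d, -, hd⟩ := h
    by_cases hc : R (Aux.empty.take d.1, p, d.2.1) d.2.2
    · rw [if_pos hc, Option.some.injEq] at hd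
      subst hd
      exact (hUW _ _ _).2 ⟨d.1, (hWR _).2 ⟨d.2.2, hc⟩⟩
    · simp [hc] at hd
  -- The first success among the candidates below `t`: lengthening the list at its end keeps the
  -- head, which gives monotonicity in `t`.
  refine ⟨fun t p => ((List.range t).filterMap (f p)).head?, ?_, ?_, ?_⟩
  · exact Primrec.list_head?.comp (Primrec.listFilterMap (Primrec.list_range.comp Primrec.fst)
      (hf.comp (Primrec.snd.comp Primrec.fst) Primrec.snd))
  · intro t t' p x h hx
    obtain ⟨k, rfl⟩ := Nat.exists_eq_add_of_le h
    simp only [List.range_add, List.filterMap_append, List.head?_append, hx, Option.some_or]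
  · intro p x
    constructor
    · intro h
      obtain ⟨n, hn⟩ := (hUW _ _ _).1 h
      obtain ⟨s, hs⟩ := (hWR _).1 hn
      have he : f p (Encodable.encode (n, x, s)) = some x := by
        simp only [f, Encodable.encodek, Option.bind_some]
        exact if_pos hs
      refine ⟨Encodable.encode (n, x, s) + 1, ?_⟩
      have hne : x ∈ (List.range (Encodable.encode (n, x, s) + 1)).filterMap (f p) :=
        List.mem_filterMap.2 ⟨_, by simp, he⟩
      obtain ⟨z, hz⟩ := Option.isSome_iff_exists.1
        (List.isSome_head?.2 (List.ne_nil_of_mem hne))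
      rw [hz]
      obtain ⟨e, -, he'⟩ := List.mem_filterMap.1 (List.mem_of_head? hz)
      rw [Part.mem_unique (hfU he') h]
    · rintro ⟨t, ht⟩
      obtain ⟨e, -, he⟩ := List.mem_filterMap.1 (List.mem_of_head? ht)
      exact hfU he

/-! ### Upper bounds for complexity -/

theorem exists_forall_of_mono {α : Type*} {P : α → ℕ → Prop} (hP : ∀ {a m n}, m ≤ n → P a m → P a n)
    (l : List α) (h : ∀ a ∈ l, ∃ n, P a n) : ∃ n, ∀ a ∈ l, P a n := by
  induction l with
  | nil => exact ⟨0, by simp⟩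
  | cons a l ih =>
    obtain ⟨n, hn⟩ := ih fun b hb => h b (List.mem_cons_of_mem _ hb)
    obtain ⟨m, hm⟩ := h a List.mem_cons_self
    refine ⟨max m n, fun b hb => ?_⟩
    rcases List.mem_cons.1 hb with rfl | hb
    · exact hP (le_max_left _ _) hm
    · exact hP (le_max_right _ _) (hn b hb)

/-! ### Prefix algorithms generated by consistent systems of descriptions -/

section Closure

variable {β : Type*}

/-- Some prefix of `p` describes `x`. -/
def PrefixDescribes (R : List (Option Bool) × Str × Str → β → Prop) (y : Aux) (p x : Str) : Prop :=
  ∃ q s n b, q ++ s = p ∧ R (y.take n, q, x) b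

/-- Descriptions do not conflict along the prefix order of programs. -/
def Consistent (R : List (Option Bool) × Str × Str → β → Prop) : Prop :=
  ∀ {y p s x x' n n' b b'}, R (Aux.take y n, p, x) b → R (Aux.take y n', p ++ s, x') b' → x = x'

/-- All sufficiently long extensions of `p` describe `x`. -/
def ClosureDescribes (R : List (Option Bool) × Str × Str → β → Prop) (y : Aux) (p x : Str) : Prop :=
  ∃ k, ∀ s ∈ allStr k, PrefixDescribes R y (p ++ s) x

variable {R : List (Option Bool) × Str × Str → β → Prop}

theorem PrefixDescribes.append {y : Aux} {p x : Str} (h : PrefixDescribes R y p x) (s : Str) :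
    PrefixDescribes R y (p ++ s) x := by
  obtain ⟨q, r, n, b, rfl, hb⟩ := h
  exact ⟨q, r ++ s, n, b, by simp, hb⟩

theorem PrefixDescribes.unique (hR : Consistent R) {y : Aux} {p x x' : Str}
    (h : PrefixDescribes R y p x) (h' : PrefixDescribes R y p x') : x = x' := by
  obtain ⟨q, r, n, b, rfl, hb⟩ := h
  obtain ⟨q', r', n', b', he, hb'⟩ := h'
  rcases List.append_eq_append_iff.1 he with ⟨t, rfl, -⟩ | ⟨t, rfl, -⟩
  · exact (hR hb' hb).symm
  · exact hR hb hb'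

theorem ClosureDescribes.exists_forall_le {y : Aux} {p x : Str} (h : ClosureDescribes R y p x) :
    ∃ k, ∀ s : Str, k ≤ s.length → PrefixDescribes R y (p ++ s) x := by
  obtain ⟨k, hk⟩ := h
  refine ⟨k, fun s hs => ?_⟩
  have := (hk (s.take k) (by simpa using hs)).append (s.drop k)
  rwa [List.append_assoc, List.take_append_drop] at this

theorem ClosureDescribes.unique (hR : Consistent R) {y : Aux} {p x x' : Str}
    (h : ClosureDescribes R y p x) (h' : ClosureDescribes R y p x') : x = x' := by
  obtain ⟨k, hk⟩ := h.exists_forall_le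
  obtain ⟨k', hk'⟩ := h'.exists_forall_le
  exact (hk (List.replicate (max k k') false) (by simp)).unique hR (hk' _ (by simp))

/-- This is the prefix axiom. Passing to all extensions alone would give only one direction; asking
merely that all sufficiently long extensions be described gives the passage from `p0` and `p1` back
to `p`. -/
theorem closureDescribes_iff {y : Aux} {p x : Str} :
    ClosureDescribes R y p x ↔
      ClosureDescribes R y (p ++ [false]) x ∧ ClosureDescribes R y (p ++ [true]) x := by
  constructor
  · intro h
    obtain ⟨k, hk⟩ := h.exists_forall_le
    have : ∀ b, ClosureDescribes R y (p ++ [b]) x := fun b => ⟨k, fun s hs => by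
      rw [List.append_assoc]
      exact hk _ (by simp only [mem_allStr] at hs; simp [hs])⟩
    exact ⟨this _, this _⟩
  · rintro ⟨h, h'⟩
    obtain ⟨k, hk⟩ := h.exists_forall_le
    obtain ⟨k', hk'⟩ := h'.exists_forall_le
    refine ⟨max k k' + 1, fun s hs => ?_⟩
    rw [mem_allStr] at hs
    match s, hs with
    | false :: s, hs =>
      have := hk s (by simp only [List.length_cons] at hs; omega)
      simpa using this
    | true :: s, hs =>
      have := hk' s (by simp only [List.length_cons] at hs; omega)
      simpa using this

/-- The prefix algorithm generated by a system of descriptions. -/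
noncomputable def closureMachine (R : List (Option Bool) × Str × Str → β → Prop) : Machine :=
  fun y p => ⟨∃ x, ClosureDescribes R y p x, fun h => h.choose⟩

theorem mem_closureMachine (hR : Consistent R) {y : Aux} {p x : Str} :
    x ∈ closureMachine R y p ↔ ClosureDescribes R y p x := by
  constructor
  · rintro ⟨h, rfl⟩
    exact h.choose_spec
  · intro h
    exact ⟨⟨x, h⟩, ClosureDescribes.unique hR (Exists.choose_spec (⟨x, h⟩ : ∃ x, _)) h⟩

theorem isAlgorithm_closureMachine [Primcodable β] (hR : PrimrecRel R) (hc : Consistent R) :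
    (closureMachine R).IsAlgorithm := by
  let D := Str × Str × List (Option Bool) × List (Option Bool) × β
  -- A certificate `d` splits the program into a description and unused bits, splits the tape into
  -- the part inspected and the rest, and supplies the witness `b`.
  let G : List (Option Bool) × Str × Str → D → Prop := fun w d =>
    d.1 ++ d.2.1 = w.2.1 ∧ d.2.2.1 ++ d.2.2.2.1 = w.1 ∧ R (d.2.2.1, d.1, w.2.2) d.2.2.2.2
  have hG : PrimrecRel G := by
    have a1 : Primrec fun z : (List (Option Bool) × Str × Str) × D => z.2.1 :=
      Primrec.fst.comp Primrec.snd
    have a2 : Primrec fun z : (List (Option Bool) × Str × Str) × D => z.2.2 :=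
      Primrec.snd.comp Primrec.snd
    have a3 := Primrec.snd.comp a2
    have a4 := Primrec.snd.comp a3
    have b1 : Primrec fun z : (List (Option Bool) × Str × Str) × D => z.1.1 :=
      Primrec.fst.comp Primrec.fst
    have b2 : Primrec fun z : (List (Option Bool) × Str × Str) × D => z.1.2 :=
      Primrec.snd.comp Primrec.fst
    refine PrimrecPred.and ?_ (PrimrecPred.and ?_ ?_)
    · exact Primrec.eq.comp (Primrec.list_append.comp a1 (Primrec.fst.comp a2))
        (Primrec.fst.comp b2)
    · exact Primrec.eq.comp (Primrec.list_append.comp (Primrec.fst.comp a3)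
        (Primrec.fst.comp a4)) b1
    · exact hR.comp ((Primrec.fst.comp a3).pair (a1.pair (Primrec.snd.comp b2)))
        (Primrec.snd.comp a4)
  let H : List (Option Bool) × Str × Str → ℕ → Prop := fun w e =>
    ∃ d ∈ (Encodable.decode (α := D) e).toList, G w d
  have hH : PrimrecRel H := by
    have := PrimrecRel.exists_mem (α := (List (Option Bool) × Str × Str) × ℕ) (β := D)
      (R := fun z d => G z.1 d) (hG.comp (Primrec.fst.comp Primrec.fst) Primrec.snd)
      (Primrec.optionToList.comp (Primrec.decode.comp Primrec.snd))
    exact this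
  let J : List (Option Bool) × Str × Str → ℕ × ℕ → Prop := fun w c =>
    ∀ s ∈ allStr c.1, ∃ e ∈ List.range c.2, H (w.1, w.2.1 ++ s, w.2.2) e
  have hJ : PrimrecRel J := by
    refine PrimrecRel.forall_mem (α := (List (Option Bool) × Str × Str) × ℕ × ℕ) (β := Str)
      (R := fun z s => ∃ e ∈ List.range z.2.2, H (z.1.1, z.1.2.1 ++ s, z.1.2.2) e) ?_
      (primrec_allStr.comp (Primrec.fst.comp Primrec.snd))
    refine PrimrecRel.exists_mem
      (α := ((List (Option Bool) × Str × Str) × ℕ × ℕ) × Str) (β := ℕ)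
      (R := fun z e => H (z.1.1.1, z.1.1.2.1 ++ z.2, z.1.1.2.2) e) ?_
      (Primrec.list_range.comp (Primrec.snd.comp (Primrec.snd.comp Primrec.fst)))
    have b0 : Primrec fun z : (((List (Option Bool) × Str × Str) × ℕ × ℕ) × Str) × ℕ =>
      z.1.1.1 := Primrec.fst.comp (Primrec.fst.comp Primrec.fst)
    have b2 := Primrec.snd.comp b0
    refine hH.comp ((Primrec.fst.comp b0).pair (Primrec.pair ?_ (Primrec.snd.comp b2)))
      Primrec.snd
    exact Primrec.list_append.comp (Primrec.fst.comp b2) (Primrec.snd.comp Primrec.fst)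
  refine ⟨fun w => ∃ c, J w c, hJ.rePred_exists, fun y p x => ?_⟩
  rw [mem_closureMachine hc]
  constructor
  · rintro ⟨k, hk⟩
    have h1 : ∀ s ∈ allStr k, ∃ N, ∃ m ≤ N, ∃ q r b, q ++ r = p ++ s ∧ R (y.take m, q, x) b := by
      intro s hs
      obtain ⟨q, r, n, b, h1, h2⟩ := hk s hs
      exact ⟨n, n, le_rfl, q, r, b, h1, h2⟩
    -- Only finitely many extensions are involved, so one tape portion, and then one bound on the
    -- codes of certificates, serves them all.
    obtain ⟨N, hN⟩ := exists_forall_of_mono (fun {a m n} h => by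
      rintro ⟨i, hi, h2⟩
      exact ⟨i, hi.trans h, h2⟩) _ h1
    have h2 : ∀ s ∈ allStr k, ∃ M, ∃ e ∈ List.range M, H (y.take N, p ++ s, x) e := by
      intro s hs
      obtain ⟨m, hm, q, r, b, h3, h4⟩ := hN s hs
      refine ⟨Encodable.encode ((q, r, y.take m, (y.take N).drop m, b) : D) + 1,
        Encodable.encode ((q, r, y.take m, (y.take N).drop m, b) : D), by simp, ?_⟩
      refine ⟨(q, r, y.take m, (y.take N).drop m, b), by simp [D], h3, ?_, h4⟩
      exact y.take_append_drop hm
    obtain ⟨M, hM⟩ := exists_forall_of_mono (fun {a m n} h => by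
      rintro ⟨e, he, h2⟩
      exact ⟨e, by simp only [List.mem_range] at he ⊢; omega, h2⟩) _ h2
    exact ⟨N, (k, M), hM⟩
  · rintro ⟨n, ⟨k, M⟩, h⟩
    refine ⟨k, fun s hs => ?_⟩
    obtain ⟨e, -, ⟨q, r, σ, ρ, b⟩, -, h1, h2, h3⟩ := h s hs
    simp only at h1 h2 h3
    rw [Aux.eq_take_of_append h2] at h3
    exact ⟨q, r, _, b, h1, h3⟩

theorem isPrefixAlgorithm_closureMachine [Primcodable β] (hR : PrimrecRel R) (hc : Consistent R) :
    (closureMachine R).IsPrefixAlgorithm :=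
  ⟨isAlgorithm_closureMachine hR hc, fun y p x => by
    simp only [mem_closureMachine hc]
    exact closureDescribes_iff⟩

/-- A string described by all extensions of `p` of some length has complexity at most the length
of `p`, up to a constant. -/
theorem Machine.IsUniversal.exists_K_le_of_closure [Primcodable β] (hU : U.IsUniversal)
    (hR : PrimrecRel R) (hc : Consistent R) :
    ∃ c : ℕ, ∀ (y : Aux) (p x : Str), ClosureDescribes R y p x →
      (U.K x y).toNat ≤ p.length + c := by
  obtain ⟨c, h⟩ := hU.2 _ (isPrefixAlgorithm_closureMachine hR hc)
  refine ⟨c, fun y p x hx => ?_⟩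
  have h1 := Machine.K_le_length ((mem_closureMachine hc).2 hx)
  refine ENat.toNat_le_of_le_natCast ?_
  rw [Nat.cast_add]
  exact (h x y).trans (add_le_add_left h1 _)

theorem Machine.IsUniversal.exists_K_le [Primcodable β] (hU : U.IsUniversal)
    (hR : PrimrecRel R) (hc : Consistent R) :
    ∃ c : ℕ, ∀ (y : Aux) (p x : Str) (n : ℕ) (b : β), R (y.take n, p, x) b →
      (U.K x y).toNat ≤ p.length + c := by
  obtain ⟨c, h⟩ := hU.exists_K_le_of_closure hR hc
  refine ⟨c, fun y p x n b hb => h y p x ⟨0, fun s hs => ?_⟩⟩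
  exact ⟨p, s, n, b, rfl, hb⟩

end Closure

/-- A shortest program of `x`. -/
theorem Machine.IsUniversal.exists_shortest (hU : U.IsUniversal) (x : Str) (y : Aux) :
    ∃ p, x ∈ U y p ∧ p.length = (U.K x y).toNat ∧ ∀ q, x ∈ U y q → p.length ≤ q.length := by
  have hne : ∃ p, x ∈ U y p := by
    by_contra! h
    refine hU.K_ne_top x y ?_
    simp [Machine.K, h]
  obtain ⟨p, hp, hmin⟩ := WellFounded.has_min (measure List.length).wf {p : Str | x ∈ U y p} hne
  have hmin' : ∀ q, x ∈ U y q → p.length ≤ q.length := fun q hq => not_lt.1 (hmin q hq)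
  refine ⟨p, hp, ?_, hmin'⟩
  have : U.K x y = p.length :=
    le_antisymm (K_le_length hp) (le_iInf₂ fun q hq => by exact_mod_cast hmin' q hq)
  rw [this]
  simp

variable {st : ℕ → Str → Option Str}

/-! ### Total strings -/

/-- `t` codes a length `k` and a stage at which all extensions of `v` by `k` bits have halted. -/
def TotalAt (st : ℕ → Str → Option Str) (v : Str) (t : ℕ) : Prop :=
  ∀ s ∈ allStr t.unpair.1, (st t.unpair.2 (v ++ s)).isSome = true

/-- `t` is the least witness of the totality of `v`. -/
def LeastTotalAt (st : ℕ → Str → Option Str) (v : Str) (t : ℕ) : Prop :=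
  TotalAt st v t ∧ ∀ i ∈ List.range t, ¬ TotalAt st v i

theorem Machine.IsStage.primrecRel_totalAt (hst : U.IsStage st) : PrimrecRel (TotalAt st) := by
  have hu : Primrec fun z : Str × ℕ => z.2.unpair := Primrec.unpair.comp Primrec.snd
  refine PrimrecRel.forall_mem (α := Str × ℕ)
    (R := fun z s => (st z.2.unpair.2 (z.1 ++ s)).isSome = true) ?_
    (primrec_allStr.comp (Primrec.fst.comp hu))
  refine Primrec.eq.comp (Primrec.option_isSome.comp (hst.primrec.comp ?_ ?_)) (Primrec.const _)
  · exact Primrec.snd.comp (hu.comp Primrec.fst)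
  · exact Primrec.list_append.comp (Primrec.fst.comp Primrec.fst) Primrec.snd

theorem Machine.IsStage.primrecRel_leastTotalAt (hst : U.IsStage st) :
    PrimrecRel (LeastTotalAt st) := by
  refine PrimrecPred.and hst.primrecRel_totalAt ?_
  exact PrimrecRel.forall_mem (α := Str × ℕ) (R := fun z i => ¬ TotalAt st z.1 i)
    (hst.primrecRel_totalAt.comp (Primrec.fst.comp Primrec.fst) Primrec.snd).not
    (Primrec.list_range.comp Primrec.snd)

theorem Machine.IsStage.dom_iff (hst : U.IsStage st) {p : Str} :
    (U Aux.empty p).Dom ↔ ∃ t, (st t p).isSome = true := by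
  simp only [Part.dom_iff_mem, hst.mem_iff, Option.isSome_iff_exists]
  exact exists_comm

theorem Machine.IsStage.isSome_mono (hst : U.IsStage st) {t t' : ℕ} {p : Str} (h : t ≤ t')
    (hp : (st t p).isSome = true) : (st t' p).isSome = true := by
  obtain ⟨x, hx⟩ := Option.isSome_iff_exists.1 hp
  exact Option.isSome_iff_exists.2 ⟨x, hst.mono h hx⟩

theorem Machine.IsStage.total_iff (hst : U.IsStage st) {v : Str} :
    U.Total v ↔ ∃ t, TotalAt st v t := by
  constructor
  · rintro ⟨k, hk⟩
    obtain ⟨T, hT⟩ := exists_forall_of_mono (P := fun s t => (st t (v ++ s)).isSome = true)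
      (fun h hp => hst.isSome_mono h hp) (allStr k)
      (fun s hs => hst.dom_iff.1 (hk s (mem_allStr.1 hs)))
    exact ⟨Nat.pair k T, by simpa [TotalAt] using hT⟩
  · rintro ⟨t, ht⟩
    exact ⟨t.unpair.1, fun s hs => hst.dom_iff.2 ⟨_, ht s (mem_allStr.2 hs)⟩⟩

theorem Machine.IsStage.exists_leastTotalAt (hst : U.IsStage st) {v : Str} (h : U.Total v) :
    ∃ t, LeastTotalAt st v t := by
  classical
  have h' := hst.total_iff.1 h
  exact ⟨Nat.find h', Nat.find_spec h', fun i hi => Nat.find_min h' (List.mem_range.1 hi)⟩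

theorem LeastTotalAt.unique {v : Str} {t t' : ℕ} (h : LeastTotalAt st v t)
    (h' : LeastTotalAt st v t') : t = t' := by
  by_contra hne
  rcases lt_or_gt_of_ne hne with hlt | hlt
  · exact h'.2 _ (List.mem_range.2 hlt) h.1
  · exact h.2 _ (List.mem_range.2 hlt) h'.1

/-- A string computed from a total string `v` has, up to a constant, at most the complexity of the
self-delimiting code of `v`. -/
theorem Machine.IsUniversal.exists_K_le_of_leastTotalAt (hU : U.IsUniversal) (hst : U.IsStage st)
    {F : Str × ℕ → Str} (hF : Primrec F) :
    ∃ c : ℕ, ∀ v t, LeastTotalAt st v t →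
      (U.K (F (v, t)) Aux.empty).toNat ≤ (code v.length).length + v.length + c := by
  -- The least witness is required so that `t`, and with it the output `F (v, t)`, is determined by
  -- `v`.
  let R : List (Option Bool) × Str × Str → Str × ℕ → Prop := fun z b =>
    z.2.1 = code b.1.length ++ b.1 ∧ LeastTotalAt st b.1 b.2 ∧ z.2.2 = F b
  have hR : PrimrecRel R := by
    have b1 : Primrec fun z : (List (Option Bool) × Str × Str) × Str × ℕ => z.2.1 :=
      Primrec.fst.comp Primrec.snd
    have z2 : Primrec fun z : (List (Option Bool) × Str × Str) × Str × ℕ => z.1.2 :=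
      Primrec.snd.comp Primrec.fst
    refine PrimrecPred.and ?_ (PrimrecPred.and ?_ ?_)
    · exact Primrec.eq.comp (Primrec.fst.comp z2)
        (Primrec.list_append.comp (primrec_code.comp (Primrec.list_length.comp b1)) b1)
    · exact hst.primrecRel_leastTotalAt.comp b1 (Primrec.snd.comp Primrec.snd)
    · exact Primrec.eq.comp (Primrec.snd.comp z2) (hF.comp Primrec.snd)
  have hc : Consistent R := by
    rintro y p s x x' n n' ⟨v, t⟩ ⟨v', t'⟩ ⟨h1, h2, h3⟩ ⟨h4, h5, h6⟩
    simp only at h1 h2 h3 h4 h5 h6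
    rw [h1, List.append_assoc] at h4
    obtain ⟨h7, h8⟩ := code_append_inj h4
    obtain ⟨rfl, -⟩ := List.append_inj (h8.trans (List.append_nil v').symm) h7
    rw [h3, h6, h2.unique h5]
  obtain ⟨c, h⟩ := hU.exists_K_le hR hc
  refine ⟨c, fun v t ht => ?_⟩
  have := h Aux.empty (code v.length ++ v) (F (v, t)) 0 (v, t) ⟨rfl, ht, rfl⟩
  simpa using this

/-- Complexity is subadditive: a program `v` and a program relative to `v` can be joined. -/
theorem Machine.IsUniversal.exists_K_le_add (hU : U.IsUniversal) :
    ∃ c : ℕ, ∀ v x : Str, (U.K x Aux.empty).toNat ≤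
      (code v.length).length + v.length + (U.K x (Aux.str v)).toNat + c := by
  obtain ⟨W, hW, hUW⟩ := hU.1.isAlgorithm
  obtain ⟨G, hG, hWG⟩ := hW.exists_primrecRel
  let R : List (Option Bool) × Str × Str → Str × Str × ℕ × ℕ → Prop := fun z b =>
    z.2.1 = code b.1.length ++ (b.1 ++ b.2.1) ∧
      G ((Aux.str b.1).take b.2.2.1, b.2.1, z.2.2) b.2.2.2
  have hR : PrimrecRel R := by
    have b1 : Primrec fun z : (List (Option Bool) × Str × Str) × Str × Str × ℕ × ℕ => z.2.1 :=
      Primrec.fst.comp Primrec.snd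
    have b2 : Primrec fun z : (List (Option Bool) × Str × Str) × Str × Str × ℕ × ℕ => z.2.2 :=
      Primrec.snd.comp Primrec.snd
    have b3 := Primrec.snd.comp b2
    have z2 : Primrec fun z : (List (Option Bool) × Str × Str) × Str × Str × ℕ × ℕ => z.1.2 :=
      Primrec.snd.comp Primrec.fst
    refine PrimrecPred.and ?_ ?_
    · exact Primrec.eq.comp (Primrec.fst.comp z2)
        (Primrec.list_append.comp (primrec_code.comp (Primrec.list_length.comp b1))
          (Primrec.list_append.comp b1 (Primrec.fst.comp b2)))
    · exact hG.comp ((primrec_take_str.comp b1 (Primrec.fst.comp b3)).pair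
        ((Primrec.fst.comp b2).pair (Primrec.snd.comp z2))) (Primrec.snd.comp b3)
  have hRU : ∀ {z v q m s}, R z (v, q, m, s) → z.2.2 ∈ U (Aux.str v) q := by
    rintro z v q m s ⟨-, h⟩
    exact (hUW _ _ _).2 ⟨m, (hWG _).2 ⟨s, h⟩⟩
  have hc : Consistent R := by
    rintro y p s x x' n n' ⟨v, q, b⟩ ⟨v', q', b'⟩ h h'
    have h1 := h.1
    have h2 := h'.1
    simp only at h1 h2
    rw [h1, List.append_assoc] at h2
    obtain ⟨h3, h4⟩ := code_append_inj h2
    rw [List.append_assoc] at h4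
    obtain ⟨rfl, rfl⟩ := List.append_inj h4 h3
    -- The parse has fixed `v` and shown that the second inner program is `q ++ s`, so consistency
    -- is inherited from the prefix property of `U` relative to `v`.
    exact Part.mem_unique (hU.1.mem_append (hRU h) s) (hRU h')
  obtain ⟨c, h⟩ := hU.exists_K_le hR hc
  refine ⟨c, fun v x => ?_⟩
  obtain ⟨q, hq, hlen, -⟩ := hU.exists_shortest x (Aux.str v)
  obtain ⟨m, hm⟩ := (hUW _ _ _).1 hq
  obtain ⟨s, hs⟩ := (hWG _).1 hm
  have := h Aux.empty (code v.length ++ (v ++ q)) x 0 (v, q, m, s) ⟨rfl, hs⟩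
  simp only [List.length_append, hlen] at this
  omega

/-! ### Decoding relative to a program of a list -/

/-- If `v` is a program of a list of `2 ^ k` entries and all entries at the extensions of `u` have
the first component `x`, then `x` has complexity at most the length of `u` relative to `v`. -/
theorem Machine.IsUniversal.exists_K_str_le (hU : U.IsUniversal) :
    ∃ c : ℕ, ∀ (v u x : Str) (k : ℕ) (g : Str → Str × ℕ × ℕ),
      Nat.bits (Encodable.encode ((allStr k).map g)) ∈ U Aux.empty v → u.length ≤ k →
      (∀ s ∈ allStr k, u <+: s → (g s).1 = x) →
      (U.K x (Aux.str v)).toNat ≤ u.length + c := by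
  obtain ⟨st, hst⟩ := hU.1.isAlgorithm.exists_isStage
  let D := Str × List (Str × ℕ × ℕ) × ℕ × ℕ
  -- A program is an index into the list output by the auxiliary string: the list has `2 ^ k`
  -- entries exactly when the program has `k` bits, and the program's position in `allStr k` selects
  -- the entry.
  let R : List (Option Bool) × Str × Str → D → Prop := fun z b =>
    z.1 = closedTape b.1 ∧ st b.2.2.1 b.1 = some (Nat.bits (Encodable.encode b.2.1)) ∧
      b.2.1.length = (allStr z.2.1.length).length ∧
      (allStr z.2.1.length)[b.2.2.2]? = some z.2.1 ∧
      (b.2.1[b.2.2.2]?).map Prod.fst = some z.2.2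
  have hR : PrimrecRel R := by
    have b1 : Primrec fun z : (List (Option Bool) × Str × Str) × D => z.2.1 :=
      Primrec.fst.comp Primrec.snd
    have b2 : Primrec fun z : (List (Option Bool) × Str × Str) × D => z.2.2 :=
      Primrec.snd.comp Primrec.snd
    have b21 := Primrec.fst.comp b2
    have b3 := Primrec.snd.comp b2
    have b31 := Primrec.fst.comp b3
    have b32 := Primrec.snd.comp b3
    have z1 : Primrec fun z : (List (Option Bool) × Str × Str) × D => z.1.1 :=
      Primrec.fst.comp Primrec.fst
    have z2 : Primrec fun z : (List (Option Bool) × Str × Str) × D => z.1.2 :=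
      Primrec.snd.comp Primrec.fst
    have z21 := Primrec.fst.comp z2
    have hall := primrec_allStr.comp (Primrec.list_length.comp z21)
    refine PrimrecPred.and ?_ (PrimrecPred.and ?_ (PrimrecPred.and ?_ (PrimrecPred.and ?_ ?_)))
    · exact Primrec.eq.comp z1 (primrec_closedTape.comp b1)
    · exact Primrec.eq.comp (hst.primrec.comp b31 b1)
        (Primrec.option_some.comp (primrec_bits.comp (Primrec.encode.comp b21)))
    · exact Primrec.eq.comp (Primrec.list_length.comp b21) (Primrec.list_length.comp hall)
    · exact Primrec.eq.comp (Primrec.list_getElem?.comp hall b32) (Primrec.option_some.comp z21)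
    · exact Primrec.eq.comp (Primrec.option_map (Primrec.list_getElem?.comp b21 b32)
        (Primrec.fst.comp Primrec.snd)) (Primrec.option_some.comp (Primrec.snd.comp z2))
  have hc : Consistent R := by
    rintro y p s x x' n n' ⟨v, L, t, i⟩ ⟨v', L', t', i'⟩ ⟨h1, h2, h3, h4, h5⟩ ⟨h1', h2', h3', h4', h5'⟩
    simp only at h1 h2 h3 h4 h5 h1' h2' h3' h4' h5'
    obtain rfl := closedTape_eq_of_take h1 h1'
    have hL := Part.mem_unique (hst.mem_iff.2 ⟨_, h2⟩) (hst.mem_iff.2 ⟨_, h2'⟩)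
    obtain rfl := Encodable.encode_injective (bits_injective hL)
    rw [h3, length_allStr, length_allStr] at h3'
    -- Both programs have the bit length fixed by the list, so one cannot properly extend the other.
    have hs : s = [] := by
      have := Nat.pow_right_injective le_rfl h3'
      simpa using this
    subst hs
    rw [List.append_nil] at h4'
    obtain ⟨hi, -⟩ := List.getElem?_eq_some_iff.1 h4
    obtain rfl := (List.getElem?_inj hi (nodup_allStr _)).1 (h4.trans h4'.symm)
    exact Option.some_injective _ (h5.symm.trans h5')
  obtain ⟨c, h⟩ := hU.exists_K_le_of_closure hR hc
  -- All completions of `u` to `k` bits describe `x`, so the closure charges only for `u`; neither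
  -- `k` nor the length of `u` has to be encoded.
  refine ⟨c, fun v u x k g hv hu hg => h _ _ _ ⟨k - u.length, fun s hs => ?_⟩⟩
  rw [mem_allStr] at hs
  have hk : (u ++ s).length = k := by simp [hs, hu]
  obtain ⟨t, ht⟩ := hst.mem_iff.1 hv
  obtain ⟨i, hi⟩ := List.mem_iff_getElem?.1 (mem_allStr.2 hk)
  refine ⟨u ++ s, [], v.length + 1, (v, (allStr k).map g, t, i), List.append_nil _,
    take_str_succ v, ht, ?_, ?_, ?_⟩
  · simp [hk]
  · simp only [hk, hi]
  · simp only [List.getElem?_map, hi, Option.map_some]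
    rw [hg _ (mem_allStr.2 hk) (List.prefix_append _ _)]

theorem Machine.IsUniversal.exists_K_const_le (hU : U.IsUniversal) (x : Str) :
    ∃ c : ℕ, ∀ y, (U.K x y).toNat ≤ c := by
  let R : List (Option Bool) × Str × Str → Unit → Prop := fun z _ => z.2.2 = x
  have hR : PrimrecRel R := Primrec.eq.comp (Primrec.snd.comp (Primrec.snd.comp Primrec.fst))
    (Primrec.const x)
  obtain ⟨c, h⟩ := hU.exists_K_le hR (by
    intro y p s x₁ x₂ n n' b b' h h'
    exact Eq.trans h (Eq.symm h'))
  refine ⟨c, fun y => ?_⟩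
  have := h y [] x 0 () rfl
  simpa using this

/-! ### The distribution given by a total string -/

/-- The value at the extension `s` of `v`. -/
def valueAt (st : ℕ → Str → Option Str) (v : Str) (t : ℕ) (s : Str) : Str :=
  (st t.unpair.2 (v ++ s)).getD []

/-- All extensions of `w` of the given length have the value `x`. -/
def Labels (st : ℕ → Str → Option Str) (v : Str) (t : ℕ) (w x : Str) : Prop :=
  ∀ s ∈ allStr t.unpair.1, s.take w.length = w → valueAt st v t s = x

open Classical in
/-- The first shortest string labelled with `x`. -/
noncomputable def firstLabel (st : ℕ → Str → Option Str) (v : Str) (t : ℕ) (x : Str) : Str :=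
  ((strUpTo t.unpair.1).filter fun w => Labels st v t w x).head?.getD []

/-- The value at `s`, replaced by the empty string outside of the cylinder of the first label. -/
noncomputable def prunedValue (st : ℕ → Str → Option Str) (v : Str) (t : ℕ) (s : Str) : Str :=
  if s.take (firstLabel st v t (valueAt st v t s)).length =
    firstLabel st v t (valueAt st v t s) then valueAt st v t s else []

/-- The list describing the distribution of the pruned values at random extensions of `v`. -/
noncomputable def prunedList (st : ℕ → Str → Option Str) (v : Str) (t : ℕ) :
    List (Str × ℕ × ℕ) :=
  (allStr t.unpair.1).map fun s => (prunedValue st v t s, 1, (allStr t.unpair.1).length - 1)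

theorem Machine.IsStage.primrec_valueAt (hst : U.IsStage st) :
    Primrec fun z : (Str × ℕ) × Str => valueAt st z.1.1 z.1.2 z.2 := by
  refine Primrec.option_getD.comp (hst.primrec.comp ?_ ?_) (Primrec.const _)
  · exact Primrec.snd.comp (Primrec.unpair.comp (Primrec.snd.comp Primrec.fst))
  · exact Primrec.list_append.comp (Primrec.fst.comp Primrec.fst) Primrec.snd

theorem Machine.IsStage.primrecRel_labels (hst : U.IsStage st) :
    PrimrecRel fun (w : Str) (z : (Str × ℕ) × Str) => Labels st z.1.1 z.1.2 w z.2 := by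
  have z1 : Primrec fun z : Str × (Str × ℕ) × Str => z.2.1 := Primrec.fst.comp Primrec.snd
  refine PrimrecRel.forall_mem (α := Str × (Str × ℕ) × Str) (R := fun z s =>
    s.take z.1.length = z.1 → valueAt st z.2.1.1 z.2.1.2 s = z.2.2) ?_
    (primrec_allStr.comp (Primrec.fst.comp (Primrec.unpair.comp (Primrec.snd.comp z1))))
  have a : Primrec fun z : (Str × (Str × ℕ) × Str) × Str => z.1.1 := Primrec.fst.comp Primrec.fst
  refine PrimrecPred.imp ?_ ?_
  · exact Primrec.eq.comp (Primrec.list_take.comp (Primrec.list_length.comp a) Primrec.snd) a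
  · exact Primrec.eq.comp (hst.primrec_valueAt.comp ((z1.comp Primrec.fst).pair Primrec.snd))
      (Primrec.snd.comp (Primrec.snd.comp Primrec.fst))

theorem Machine.IsStage.primrec_firstLabel (hst : U.IsStage st) :
    Primrec fun z : (Str × ℕ) × Str => firstLabel st z.1.1 z.1.2 z.2 := by
  classical
  refine Primrec.option_getD.comp (Primrec.list_head?.comp ?_) (Primrec.const _)
  refine (PrimrecRel.listFilter hst.primrecRel_labels).comp ?_ Primrec.id
  exact primrec_strUpTo.comp
    (Primrec.fst.comp (Primrec.unpair.comp (Primrec.snd.comp Primrec.fst)))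

theorem Machine.IsStage.primrec_prunedValue (hst : U.IsStage st) :
    Primrec fun z : (Str × ℕ) × Str => prunedValue st z.1.1 z.1.2 z.2 := by
  have h := hst.primrec_firstLabel.comp (Primrec.fst.pair hst.primrec_valueAt)
  exact Primrec.ite (Primrec.eq.comp (Primrec.list_take.comp (Primrec.list_length.comp h)
    Primrec.snd) h) hst.primrec_valueAt (Primrec.const _)

theorem Machine.IsStage.primrec_prunedList (hst : U.IsStage st) :
    Primrec fun z : Str × ℕ => prunedList st z.1 z.2 := by
  have hall : Primrec fun z : Str × ℕ => allStr z.2.unpair.1 :=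
    primrec_allStr.comp (Primrec.fst.comp (Primrec.unpair.comp Primrec.snd))
  refine Primrec.list_map hall (Primrec.pair hst.primrec_prunedValue
    (Primrec.pair (Primrec.const 1) ?_))
  exact Primrec.nat_sub.comp (Primrec.list_length.comp (hall.comp Primrec.fst)) (Primrec.const 1)

/-- A labelled string gives a cylinder in which all pruned values are `a`, and which contains
all places where the pruned value is `a` if `a` is not empty. -/
theorem exists_cylinder {v w a : Str} {t : ℕ} (hw : w.length ≤ t.unpair.1)
    (hl : Labels st v t w a) : ∃ u : Str, u.length ≤ w.length ∧
      (∀ s ∈ allStr t.unpair.1, u <+: s → prunedValue st v t s = a) ∧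
      (a ≠ [] → ∀ s ∈ allStr t.unpair.1, prunedValue st v t s = a → u <+: s) := by
  classical
  set l := (strUpTo t.unpair.1).filter fun w => Labels st v t w a with hldef
  have hwl : w ∈ l := List.mem_filter.2 ⟨mem_strUpTo.2 hw, by simpa using hl⟩
  obtain ⟨u, r, hur⟩ := List.exists_cons_of_ne_nil (List.ne_nil_of_mem hwl)
  have hfirst : firstLabel st v t a = u := by
    rw [firstLabel, ← hldef, hur]
    rfl
  have hu : Labels st v t u a := by
    have : u ∈ l := by simp [hur]
    simpa using (List.mem_filter.1 this).2
  refine ⟨u, ?_, fun s hs hus => ?_, fun ha s hs hsa => ?_⟩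
  · have hp : l.Pairwise fun s t => s.length ≤ t.length := (pairwise_strUpTo _).filter _
    rw [hur] at hp hwl
    rcases List.mem_cons.1 hwl with rfl | h
    · exact le_rfl
    · exact List.rel_of_pairwise_cons hp h
  · have hus' := (List.prefix_iff_eq_take.1 hus).symm
    have hval := hu s hs hus'
    rw [prunedValue, hval, hfirst, if_pos hus']
  -- A nonempty value survives pruning only inside its own first cylinder. The empty string is also
  -- the replacement value, hence the exclusion of `a = []`.
  · rw [prunedValue] at hsa
    split_ifs at hsa with h
    · rw [hsa, hfirst] at h
      exact List.prefix_iff_eq_take.2 h.symm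
    · exact absurd hsa.symm ha

theorem countP_prefix {k : ℕ} {u : Str} (hu : u.length ≤ k) :
    (allStr k).countP (fun s => decide (u <+: s)) = 2 ^ (k - u.length) := by
  rw [List.countP_eq_length_filter, ← length_allStr,
    ← List.length_map (as := allStr (k - u.length)) (u ++ ·)]
  refine List.Perm.length_eq ?_
  rw [List.perm_ext_iff_of_nodup ((nodup_allStr k).filter _)
    ((nodup_allStr _).map (List.append_right_injective u))]
  intro s
  simp only [List.mem_filter, mem_allStr, decide_eq_true_eq, List.mem_map]
  constructor
  · rintro ⟨hs, r, rfl⟩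
    exact ⟨r, by rw [List.length_append] at hs; omega, rfl⟩
  · rintro ⟨r, hr, rfl⟩
    exact ⟨by rw [List.length_append]; omega, List.prefix_append _ _⟩

theorem weightsOf_cons (t : Str × ℕ × ℕ) (L : List (Str × ℕ × ℕ)) :
    weightsOf (t :: L) =
      Finsupp.single t.1 ((t.2.1 : ℚ≥0) / ((t.2.2 : ℚ≥0) + 1)) + weightsOf L := by
  simp [weightsOf]

theorem weightsOf_map_apply {α : Type*} (l : List α) (g : α → Str) (N : ℕ) (a : Str) :
    weightsOf (l.map fun s => (g s, 1, N)) a =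
      (l.countP fun s => decide (g s = a)) / ((N : ℚ≥0) + 1) := by
  induction l with
  | nil => simp [weightsOf]
  | cons b l ih =>
    rw [List.map_cons, weightsOf_cons, Finsupp.add_apply, ih, List.countP_cons,
      Finsupp.single_apply]
    by_cases h : g b = a
    · simp only [h, if_true, decide_true]
      push_cast
      rw [← add_div, add_comm]
    · simp [h]

theorem isProb_weightsOf_map {α : Type*} (l : List α) (g : α → Str) (hl : l ≠ []) :
    (weightsOf (l.map fun s => (g s, 1, l.length - 1))).IsProb := by
  have key : ∀ (r : List α) (N : ℕ), (weightsOf (r.map fun s => (g s, 1, N))).sum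
      (fun _ w => w) = r.length / ((N : ℚ≥0) + 1) := by
    intro r N
    induction r with
    | nil => simp [weightsOf]
    | cons b r ih =>
      rw [List.map_cons, weightsOf_cons, Finsupp.sum_add_index' (by simp) (by simp),
        Finsupp.sum_single_index (by simp), ih, List.length_cons]
      push_cast
      rw [← add_div, add_comm]
  rw [Weights.IsProb, key]
  have hpos : 0 < l.length := List.length_pos_iff.2 hl
  -- A stored denominator `m` stands for `m + 1`, so storing `l.length - 1` gives each entry the
  -- weight `1 / l.length`.
  have : ((l.length - 1 : ℕ) : ℚ≥0) + 1 = l.length := by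
    exact_mod_cast Nat.sub_add_cancel hpos
  rw [this, div_self]
  exact_mod_cast hpos.ne'

theorem isProb_prunedList (v : Str) (t : ℕ) : (weightsOf (prunedList st v t)).IsProb :=
  isProb_weightsOf_map _ _ (List.ne_nil_of_length_pos (by simp))

theorem prunedList_apply (v a : Str) (t : ℕ) : weightsOf (prunedList st v t) a =
    ((allStr t.unpair.1).countP fun s => decide (prunedValue st v t s = a)) /
      (2 : ℚ≥0) ^ t.unpair.1 := by
  rw [prunedList, weightsOf_map_apply]
  congr 1
  rw [length_allStr]
  exact_mod_cast Nat.sub_add_cancel Nat.one_le_two_pow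

/-- The weight of `a` is at least that of the cylinder of `u`. -/
theorem le_prunedList_apply {v u a : Str} {t : ℕ} (hu : u.length ≤ t.unpair.1)
    (h : ∀ s ∈ allStr t.unpair.1, u <+: s → prunedValue st v t s = a) :
    ((2 : ℚ≥0) ^ u.length)⁻¹ ≤ weightsOf (prunedList st v t) a := by
  rw [prunedList_apply, le_div_iff₀ (by positivity), mul_comm,
    ← pow_sub₀ _ two_ne_zero hu]
  have := List.countP_mono_left (p := fun s => decide (u <+: s))
    (q := fun s => decide (prunedValue st v t s = a)) (l := allStr t.unpair.1)
    (fun s hs hp => by simpa using h s hs (by simpa using hp))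
  rw [countP_prefix hu] at this
  exact_mod_cast this

theorem prunedList_apply_le {v u a : Str} {t : ℕ} (hu : u.length ≤ t.unpair.1)
    (h : ∀ s ∈ allStr t.unpair.1, prunedValue st v t s = a → u <+: s) :
    weightsOf (prunedList st v t) a ≤ ((2 : ℚ≥0) ^ u.length)⁻¹ := by
  rw [prunedList_apply, div_le_iff₀ (by positivity), mul_comm,
    ← pow_sub₀ _ two_ne_zero hu]
  have := List.countP_mono_left (q := fun s => decide (u <+: s))
    (p := fun s => decide (prunedValue st v t s = a)) (l := allStr t.unpair.1)
    (fun s hs hp => by simpa using h s hs (by simpa using hp))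
  rw [countP_prefix hu] at this
  exact_mod_cast this

/-- A shortest program of `a` that passes through the total string `v` gives a label. -/
theorem Machine.IsStage.labels_of_shortest (hU : U.IsPrefixAlgorithm) (hst : U.IsStage st)
    {v w a : Str} {t : ℕ} (ht : TotalAt st v t) (hp : a ∈ U Aux.empty (v ++ w))
    (hmin : ∀ q, a ∈ U Aux.empty q → (v ++ w).length ≤ q.length) :
    w.length ≤ t.unpair.1 ∧ Labels st v t w a := by
  have hval : ∀ s ∈ allStr t.unpair.1, valueAt st v t s ∈ U Aux.empty (v ++ s) := by
    intro s hs
    obtain ⟨x, hx⟩ := Option.isSome_iff_exists.1 (ht s hs)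
    rw [valueAt, hx, Option.getD_some]
    exact hst.mem_iff.2 ⟨_, hx⟩
  constructor
  -- Otherwise `v` with the first `k` bits of `w` already halts, necessarily with output `a`,
  -- contradicting the minimal length of `v ++ w`.
  · by_contra! hlt
    have hs : w.take t.unpair.1 ∈ allStr t.unpair.1 := by
      rw [mem_allStr, List.length_take]
      omega
    have h1 := hval _ hs
    have h2 := hU.mem_append h1 (w.drop t.unpair.1)
    rw [List.append_assoc, List.take_append_drop] at h2
    rw [Part.mem_unique h2 hp] at h1
    have := hmin _ h1
    simp only [List.length_append, List.length_take] at this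
    omega
  · intro s hs hw
    obtain ⟨r, rfl⟩ := List.prefix_iff_eq_take.2 hw.symm
    have := hU.mem_append hp r
    rw [List.append_assoc] at this
    exact Part.mem_unique (hval _ hs) this

/-! ### Minimal total strings and the halting sequence -/

/-- `v` is total and no proper prefix of `v` is. -/
def Machine.MinTotal (U : Machine) (v : Str) : Prop :=
  U.Total v ∧ ∀ u, u <+: v → u ≠ v → ¬ U.Total u

theorem Machine.IsPrefixAlgorithm.total_of_total (hU : U.IsPrefixAlgorithm) {v : Str}
    (h0 : U.Total (v ++ [false])) (h1 : U.Total (v ++ [true])) : U.Total v := by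
  obtain ⟨k, hk⟩ := h0
  obtain ⟨m, hm⟩ := h1
  have ext : ∀ {q k}, (∀ s : Str, s.length = k → (U Aux.empty (q ++ s)).Dom) →
      ∀ s : Str, k ≤ s.length → (U Aux.empty (q ++ s)).Dom := by
    intro q k h s hs
    obtain ⟨x, hx⟩ := Part.dom_iff_mem.1 (h (s.take k) (by simpa using hs))
    have := hU.mem_append hx (s.drop k)
    rw [List.append_assoc, List.take_append_drop] at this
    exact Part.dom_iff_mem.2 ⟨x, this⟩
  refine ⟨max k m + 1, fun s hs => ?_⟩
  match s, hs with
  | false :: s, hs =>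
    have := ext hk s (by simp only [List.length_cons] at hs; omega)
    simpa using this
  | true :: s, hs =>
    have := ext hm s (by simp only [List.length_cons] at hs; omega)
    simpa using this

theorem exists_split {v v' : Str} (hlen : v.length = v'.length) (hne : v ≠ v') :
    ∃ z b r r', v = z ++ b :: r ∧ v' = z ++ (!b) :: r' := by
  induction v generalizing v' with
  | nil => exact absurd (List.length_eq_zero_iff.1 hlen.symm).symm hne
  | cons b v ih =>
    cases v' with
    | nil => simp at hlen
    | cons b' v' =>
      by_cases hb : b = b'
      · subst hb
        obtain ⟨z, c, r, r', rfl, rfl⟩ := ih (by simpa using hlen) (by simpa using hne)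
        exact ⟨b :: z, c, r, r', rfl, rfl⟩
      · refine ⟨[], b, v, v', rfl, ?_⟩
        cases b <;> cases b' <;> simp_all

/-- A left-total machine has at most one minimal total string of each length. -/
theorem Machine.MinTotal.unique (hU : U.IsPrefixAlgorithm) (hleft : U.IsLeftTotal) {v v' : Str}
    (h : U.MinTotal v) (h' : U.MinTotal v') (hlen : v.length = v'.length) : v = v' := by
  have key : ∀ {z r r' : Str}, U.MinTotal (z ++ false :: r) → U.MinTotal (z ++ true :: r') →
      r.length = r'.length → False := by
    intro z r r' h h' hr
    obtain ⟨k, hk⟩ := h'.1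
    have h0 : U.Total (z ++ [false]) := by
      refine hleft z (r' ++ List.replicate k false) ?_
      have := hk (List.replicate k false) List.length_replicate
      simpa using this
    -- With `z0` total, a nonempty `r` contradicts minimality of the left string. If `r` is empty,
    -- then `z0` and `z1` are both total, hence so is `z`, again contradicting minimality.
    cases r with
    | nil =>
      obtain rfl := List.length_eq_zero_iff.1 hr.symm
      exact h.2 z (List.prefix_append _ _) (by simp) (hU.total_of_total h.1 h'.1)
    | cons b r => exact h.2 _ ⟨b :: r, by simp⟩ (by simp) h0
  by_contra hne
  obtain ⟨z, b, r, r', rfl, rfl⟩ := exists_split hlen hne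
  have hr : r.length = r'.length := by simpa using hlen
  cases b
  · exact key h h' hr
  · exact key h' h hr.symm

/-- Every halting program has a minimal total prefix. -/
theorem Machine.IsPrefixAlgorithm.exists_minTotal_prefix (hU : U.IsPrefixAlgorithm) {p x : Str}
    (h : x ∈ U Aux.empty p) : ∃ v w, v ++ w = p ∧ U.MinTotal v := by
  have hp : U.Total p :=
    ⟨0, fun s _ => Part.dom_iff_mem.2 ⟨x, hU.mem_append h s⟩⟩
  obtain ⟨v, ⟨⟨w, hw⟩, hv⟩, hmin⟩ := WellFounded.has_min (measure List.length).wf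
    {v : Str | v <+: p ∧ U.Total v} ⟨p, List.prefix_refl p, hp⟩
  refine ⟨v, w, hw, hv, fun u hu hne ht => hmin u ⟨hu.trans ⟨w, hw⟩, ht⟩ ?_⟩
  exact lt_of_le_of_ne hu.length_le fun he => hne (hu.eq_of_length he)

theorem Machine.halting_encode {p : Str} :
    U.halting (Encodable.encode p) = true ↔ (U Aux.empty p).Dom := by
  simp [Machine.halting]

/-! ### Deciding totality from a tape that declares which short programs halt -/

section Oracle

variable (st) (m : ℕ)

/-- The oracle tape `σ` is long enough and all strings of length at most `m` that it declares
halting have halted at the stage `T`. -/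
def Settled (σ : List (Option Bool)) (T : ℕ) : Prop :=
  ∀ q ∈ strUpTo m, σ[Encodable.encode q]? = some (some false) ∨
    σ[Encodable.encode q]? = some (some true) ∧ (st T q).isSome = true

/-- The output of a string of length at most `m` witnesses the totality of `u`. -/
def OracleTotal (σ : List (Option Bool)) (T : ℕ) (u : Str) : Prop :=
  ∃ q ∈ strUpTo m, σ[Encodable.encode q]? = some (some true) ∧
    TotalAt st u ((st T q).getD []).length

/-- The oracle version of `Machine.MinTotal`. -/
def OracleMinTotal (σ : List (Option Bool)) (T : ℕ) (v : Str) : Prop :=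
  OracleTotal st m σ T v ∧ ∀ j ∈ List.range v.length, ¬ OracleTotal st m σ T (v.take j)

variable {st m}

theorem read_of_getElem?_take {y : Aux} {n e : ℕ} {z : Option Bool}
    (h : (y.take n)[e]? = some z) : y.read e = z := by
  obtain ⟨hlt, h⟩ := List.getElem?_eq_some_iff.1 h
  simpa [Aux.take] using h

/-- Two settled states on the same tape read the same declarations and see the same outputs, whether
or not the declarations are correct. This matters because consistency of descriptions is demanded
for every auxiliary input. -/
theorem OracleTotal.transfer (hst : U.IsStage st) {y : Aux} {n n' T T' : ℕ} {u : Str}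
    (hs : Settled st m (y.take n) T) (hs' : Settled st m (y.take n') T')
    (h : OracleTotal st m (y.take n) T u) : OracleTotal st m (y.take n') T' u := by
  obtain ⟨q, hq, h1, h2⟩ := h
  have hr := read_of_getElem?_take h1
  rcases hs q hq with h3 | ⟨-, h3⟩
  · simp [h1] at h3
  rcases hs' q hq with h4 | ⟨h4, h5⟩
  · have := read_of_getElem?_take h4
    simp [hr] at this
  refine ⟨q, hq, h4, ?_⟩
  obtain ⟨x, hx⟩ := Option.isSome_iff_exists.1 h3
  obtain ⟨x', hx'⟩ := Option.isSome_iff_exists.1 h5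
  have : x = x' := Part.mem_unique (hst.mem_iff.2 ⟨_, hx⟩) (hst.mem_iff.2 ⟨_, hx'⟩)
  subst this
  rw [hx] at h2
  rwa [hx']

theorem OracleMinTotal.transfer (hst : U.IsStage st) {y : Aux} {n n' T T' : ℕ} {u : Str}
    (hs : Settled st m (y.take n) T) (hs' : Settled st m (y.take n') T')
    (h : OracleMinTotal st m (y.take n) T u) : OracleMinTotal st m (y.take n') T' u :=
  ⟨h.1.transfer hst hs hs', fun j hj hj' => h.2 j hj (hj'.transfer hst hs' hs)⟩

/-- Tuples of a bound, an oracle tape and a stage. -/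
abbrev OracleState := ℕ × List (Option Bool) × ℕ

theorem primrec_oracle_getElem? {α : Type*} [Primcodable α] {f : α → OracleState} {g : α → Str}
    (hf : Primrec f) (hg : Primrec g) :
    Primrec fun a => (f a).2.1[Encodable.encode (g a)]? :=
  Primrec.list_getElem?.comp (Primrec.fst.comp (Primrec.snd.comp hf)) (Primrec.encode.comp hg)

theorem Machine.IsStage.primrecPred_settled (hst : U.IsStage st) :
    PrimrecPred fun o : OracleState => Settled st o.1 o.2.1 o.2.2 := by
  refine PrimrecRel.forall_mem (R := fun (o : OracleState) (q : Str) =>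
    o.2.1[Encodable.encode q]? = some (some false) ∨
    o.2.1[Encodable.encode q]? = some (some true) ∧ (st o.2.2 q).isSome = true) ?_
    (primrec_strUpTo.comp Primrec.fst)
  have h := primrec_oracle_getElem? (Primrec.fst (α := OracleState) (β := Str)) Primrec.snd
  refine PrimrecPred.or (Primrec.eq.comp h (Primrec.const _))
    (PrimrecPred.and (Primrec.eq.comp h (Primrec.const _)) ?_)
  exact Primrec.eq.comp (Primrec.option_isSome.comp (hst.primrec.comp
    (Primrec.snd.comp (Primrec.snd.comp Primrec.fst)) Primrec.snd)) (Primrec.const _)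

theorem Machine.IsStage.primrecRel_oracleTotal (hst : U.IsStage st) :
    PrimrecRel fun (o : OracleState) (u : Str) => OracleTotal st o.1 o.2.1 o.2.2 u := by
  refine PrimrecRel.exists_mem (R := fun (z : OracleState × Str) (q : Str) =>
    z.1.2.1[Encodable.encode q]? = some (some true) ∧
    TotalAt st z.2 ((st z.1.2.2 q).getD []).length) ?_
    (primrec_strUpTo.comp (Primrec.fst.comp Primrec.fst))
  have o : Primrec fun z : (OracleState × Str) × Str => z.1.1 := Primrec.fst.comp Primrec.fst
  refine PrimrecPred.and
    (Primrec.eq.comp (primrec_oracle_getElem? o Primrec.snd) (Primrec.const _)) ?_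
  refine hst.primrecRel_totalAt.comp (Primrec.snd.comp Primrec.fst) (Primrec.list_length.comp ?_)
  exact Primrec.option_getD.comp
    (hst.primrec.comp (Primrec.snd.comp (Primrec.snd.comp o)) Primrec.snd) (Primrec.const _)

theorem Machine.IsStage.primrecRel_oracleMinTotal (hst : U.IsStage st) :
    PrimrecRel fun (o : OracleState) (u : Str) => OracleMinTotal st o.1 o.2.1 o.2.2 u := by
  refine PrimrecPred.and hst.primrecRel_oracleTotal ?_
  refine PrimrecRel.forall_mem (R := fun (z : OracleState × Str) (j : ℕ) =>
    ¬ OracleTotal st z.1.1 z.1.2.1 z.1.2.2 (z.2.take j)) ?_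
    (Primrec.list_range.comp (Primrec.list_length.comp Primrec.snd))
  exact (hst.primrecRel_oracleTotal.comp (Primrec.fst.comp Primrec.fst)
    (Primrec.list_take.comp Primrec.snd (Primrec.snd.comp Primrec.fst))).not

end Oracle

theorem primrec_replicate : Primrec fun t => List.replicate t false := by
  refine (Primrec.list_map Primrec.list_range (Primrec.const false).to₂).of_eq fun n => ?_
  simp

/-- With the halting sequence as the oracle, totality of short strings is decided. -/
theorem oracleTotal_halting_iff (hU : U.IsUniversal) (hst : U.IsStage st) {m n T : ℕ} {u : Str}
    (hm : ∀ t, LeastTotalAt st u t →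
      (U.K (List.replicate t false) Aux.empty).toNat ≤ m)
    (hs : Settled st m ((Aux.seq U.halting).take n) T) :
    OracleTotal st m ((Aux.seq U.halting).take n) T u ↔ U.Total u := by
  constructor
  · rintro ⟨q, -, -, h⟩
    exact hst.total_iff.2 ⟨_, h⟩
  · intro h
    obtain ⟨t, ht⟩ := hst.exists_leastTotalAt h
    -- The least witness `t` is carried by a string of length `t`; its shortest program is among the
    -- inspected strings, and the oracle confirms that it halts.
    obtain ⟨q, hq, hlen, -⟩ := hU.exists_shortest (List.replicate t false) Aux.empty
    have hqm : q ∈ strUpTo m := by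
      rw [mem_strUpTo, hlen]
      exact hm t ht
    have hd : U.halting (Encodable.encode q) = true :=
      Machine.halting_encode.2 (Part.dom_iff_mem.2 ⟨_, hq⟩)
    rcases hs q hqm with h3 | ⟨h3, h4⟩
    · have := read_of_getElem?_take h3
      simp [Aux.read, hd] at this
    · refine ⟨q, hqm, h3, ?_⟩
      obtain ⟨x, hx⟩ := Option.isSome_iff_exists.1 h4
      have : x = List.replicate t false := Part.mem_unique (hst.mem_iff.2 ⟨_, hx⟩) hq
      rw [hx, Option.getD_some, this, List.length_replicate]
      exact ht.1

/-- Only finitely many strings are inspected: the tape must reach beyond their numbers and the stage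
beyond their halting times. Any later stage works too, which leaves room to wait for another
computation. -/
theorem exists_settled_halting (hst : U.IsStage st) (m : ℕ) :
    ∃ n T₀, ∀ T, T₀ ≤ T → Settled st m ((Aux.seq U.halting).take n) T := by
  obtain ⟨n, hn⟩ := exists_forall_of_mono (P := fun (q : Str) n => Encodable.encode q < n)
    (fun h h' => h'.trans_le h) (strUpTo m) (fun q _ => ⟨_, Nat.lt_succ_self _⟩)
  obtain ⟨T₀, hT⟩ := exists_forall_of_mono
    (P := fun (q : Str) T => (U Aux.empty q).Dom → (st T q).isSome = true)
    (fun h h' hd => hst.isSome_mono h (h' hd)) (strUpTo m) (fun q _ => by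
      by_cases hd : (U Aux.empty q).Dom
      · obtain ⟨t, ht⟩ := hst.dom_iff.1 hd
        exact ⟨t, fun _ => ht⟩
      · exact ⟨0, fun h => absurd h hd⟩)
  refine ⟨n, T₀, fun T hle q hq => ?_⟩
  have hget : ((Aux.seq U.halting).take n)[Encodable.encode q]? =
      some (some (U.halting (Encodable.encode q))) := by
    rw [Aux.take, List.getElem?_map, List.getElem?_range (hn q hq)]
    rfl
  rw [hget]
  by_cases hd : (U Aux.empty q).Dom
  · right
    exact ⟨by rw [Machine.halting_encode.2 hd], hst.isSome_mono hle (hT q hq hd)⟩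
  · left
    have := mt Machine.halting_encode.1 hd
    rw [Bool.not_eq_true] at this
    rw [this]

/-- Relative to the halting sequence, a program can be described by the length of its minimal
total prefix and the remaining bits. -/
theorem Machine.IsUniversal.exists_K_halting_le (hU : U.IsUniversal) (hleft : U.IsLeftTotal) :
    ∃ c : ℕ, ∀ v w x : Str, U.MinTotal v → x ∈ U Aux.empty (v ++ w) →
      (U.K x (Aux.seq U.halting)).toNat ≤ (code v.length).length + w.length + c := by
  obtain ⟨st, hst⟩ := hU.1.isAlgorithm.exists_isStage
  obtain ⟨c₁, hc₁⟩ := hU.exists_K_le_of_leastTotalAt hst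
    (F := fun z => List.replicate z.2 false) (primrec_replicate.comp Primrec.snd)
  -- `B n` bounds the complexity of a totality witness for strings of length at most `n`: the code
  -- of the length takes at most `2 * n + 1` bits and the string at most `n`.
  let B : ℕ → ℕ := fun n => n + n + n + 1 + c₁
  have hB : Primrec B := by
    refine Primrec.nat_add.comp (Primrec.succ.comp ?_) (Primrec.const c₁)
    exact Primrec.nat_add.comp (Primrec.nat_add.comp Primrec.id Primrec.id) Primrec.id
  have hKB : ∀ {u n t}, u.length ≤ n → LeastTotalAt st u t →
      (U.K (List.replicate t false) Aux.empty).toNat ≤ B n := by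
    intro u n t hun ht
    have h1 : (U.K (List.replicate t false) Aux.empty).toNat ≤ _ := hc₁ u t ht
    have h2 : Nat.size u.length ≤ u.length := Nat.size_le.2 Nat.lt_two_pow_self
    rw [length_code] at h1
    simp only [B]
    omega
  let D := Str × Str × ℕ
  let R : List (Option Bool) × Str × Str → D → Prop := fun z b =>
    z.2.1 = code b.1.length ++ b.2.1 ∧ Settled st (B b.1.length) z.1 b.2.2 ∧
      OracleMinTotal st (B b.1.length) z.1 b.2.2 b.1 ∧
      (∀ v ∈ allStr b.1.length, OracleMinTotal st (B b.1.length) z.1 b.2.2 v → v = b.1) ∧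
      st b.2.2 (b.1 ++ b.2.1) = some z.2.2
  have hR : PrimrecRel R := by
    have b1 : Primrec fun z : (List (Option Bool) × Str × Str) × D => z.2.1 :=
      Primrec.fst.comp Primrec.snd
    have b2 : Primrec fun z : (List (Option Bool) × Str × Str) × D => z.2.2 :=
      Primrec.snd.comp Primrec.snd
    have b21 := Primrec.fst.comp b2
    have b22 := Primrec.snd.comp b2
    have z1 : Primrec fun z : (List (Option Bool) × Str × Str) × D => z.1.1 :=
      Primrec.fst.comp Primrec.fst
    have z2 : Primrec fun z : (List (Option Bool) × Str × Str) × D => z.1.2 :=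
      Primrec.snd.comp Primrec.fst
    have hlen := Primrec.list_length.comp b1
    have ho : Primrec fun z : (List (Option Bool) × Str × Str) × D =>
        ((B z.2.1.length, z.1.1, z.2.2.2) : OracleState) :=
      (hB.comp hlen).pair (z1.pair b22)
    refine PrimrecPred.and ?_ (PrimrecPred.and ?_ (PrimrecPred.and ?_ (PrimrecPred.and ?_ ?_)))
    · exact Primrec.eq.comp (Primrec.fst.comp z2)
        (Primrec.list_append.comp (primrec_code.comp hlen) b21)
    · exact hst.primrecPred_settled.comp ho
    · exact hst.primrecRel_oracleMinTotal.comp ho b1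
    · refine PrimrecRel.forall_mem (R := fun (z : (List (Option Bool) × Str × Str) × D) v =>
        OracleMinTotal st (B z.2.1.length) z.1.1 z.2.2.2 v → v = z.2.1) ?_
        (primrec_allStr.comp hlen)
      exact PrimrecPred.imp
        (hst.primrecRel_oracleMinTotal.comp (ho.comp Primrec.fst) Primrec.snd)
        (Primrec.eq.comp Primrec.snd (b1.comp Primrec.fst))
    · exact Primrec.eq.comp (hst.primrec.comp b22 (Primrec.list_append.comp b1 b21))
        (Primrec.option_some.comp (Primrec.snd.comp z2))
  have hc : Consistent R := by
    rintro y p s x x' n n' ⟨v, w, T⟩ ⟨v', w', T'⟩ ⟨h1, h2, h3, h4, h5⟩ ⟨h1', h2', h3', h4', h5'⟩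
    simp only at h1 h2 h3 h4 h5 h1' h2' h3' h4' h5'
    rw [h1, List.append_assoc] at h1'
    obtain ⟨hlen, rfl⟩ := code_append_inj h1'
    rw [← hlen] at h2' h3'
    -- On an arbitrary tape nothing else forces uniqueness of the minimal total string, so
    -- uniqueness is a clause of the description; the transferred `v'` must then equal `v`.
    obtain rfl := h4 v' (mem_allStr.2 hlen.symm) (h3'.transfer hst h2' h2)
    have := hU.1.mem_append (hst.mem_iff.2 ⟨_, h5⟩) s
    rw [List.append_assoc] at this
    exact Part.mem_unique this (hst.mem_iff.2 ⟨_, h5'⟩)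
  obtain ⟨c, h⟩ := hU.exists_K_le hR hc
  refine ⟨c, fun v w x hv hx => ?_⟩
  obtain ⟨n, T₀, hset⟩ := exists_settled_halting hst (B v.length)
  obtain ⟨T₁, hT₁⟩ := hst.mem_iff.1 hx
  have hs := hset (max T₀ T₁) (le_max_left _ _)
  have htot : ∀ {u : Str}, u.length ≤ v.length →
      (OracleTotal st (B v.length) ((Aux.seq U.halting).take n) (max T₀ T₁) u ↔ U.Total u) :=
    fun hu => oracleTotal_halting_iff hU hst (fun t ht => hKB hu ht) hs
  have hmin : ∀ {u : Str}, u.length ≤ v.length →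
      (OracleMinTotal st (B v.length) ((Aux.seq U.halting).take n) (max T₀ T₁) u ↔
        U.MinTotal u) := by
    intro u hu
    refine and_congr (htot hu) ⟨fun h z hz hne => ?_, fun h j hj => ?_⟩
    · have hlt : z.length < u.length :=
        lt_of_le_of_ne hz.length_le fun he => hne (hz.eq_of_length he)
      have := h z.length (List.mem_range.2 hlt)
      rw [← List.prefix_iff_eq_take.1 hz] at this
      exact fun ht => this ((htot (by omega)).2 ht)
    · rw [List.mem_range] at hj
      have hl : (u.take j).length = j := by
        rw [List.length_take]
        omega
      rw [htot (by omega)]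
      refine h _ (List.take_prefix _ _) fun he => ?_
      rw [he] at hl
      omega
  have := h (Aux.seq U.halting) (code v.length ++ w) x n (v, w, max T₀ T₁)
    ⟨rfl, hs, (hmin le_rfl).2 hv, fun v' hv' hm => ?_, hst.mono (le_max_right _ _) hT₁⟩
  · simpa using this
  · have hl := mem_allStr.1 hv'
    exact ((hmin hl.le).1 hm).unique hU.1 hleft hv hl

end AlgInfo

/-! ### The parameters of the pruned distribution -/

open AlgInfo in
/-- The distribution obtained from the minimal total prefix, of length `n`, of a shortest program
of `a`. -/
theorem AlgInfo.Machine.IsUniversal.exists_distribution {U : Machine} (hU : U.IsUniversal)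
    (hleft : U.IsLeftTotal) :
    ∃ c : ℕ, ∀ a : Str, ∃ (v : Str) (Q : Weights) (n : ℕ),
      (U.Outputs v Q ∧ Q.IsProb ∧ 0 < Q a) ∧ v.length ≤ n + 2 * Nat.size n + c ∧
      -(c : ℤ) ≤ U.nonrandomness a Q v ∧
      U.nonrandomness a Q v ≤ 4 * (Nat.size n : ℤ) + c ∧
      (n : ℤ) - 2 * Nat.size n - c ≤ U.infoHalting a := by
  obtain ⟨st, hst⟩ := hU.1.isAlgorithm.exists_isStage
  obtain ⟨c₁, hc₁⟩ := hU.exists_K_le_of_leastTotalAt hst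
    (F := fun z => Nat.bits (Encodable.encode (prunedList st z.1 z.2)))
    (primrec_bits.comp (Primrec.encode.comp hst.primrec_prunedList))
  obtain ⟨c₂, hc₂⟩ := hU.exists_K_le_add
  obtain ⟨c₃, hc₃⟩ := hU.exists_K_str_le
  obtain ⟨c₄, hc₄⟩ := hU.exists_K_const_le []
  obtain ⟨c₅, hc₅⟩ := hU.exists_K_halting_le hleft
  -- `c₁` enters once through the length of `v'` and twice through the self-delimiting code of that
  -- length.
  refine ⟨3 * c₁ + 15 + c₂ + c₃ + c₄ + c₅, fun a => ?_⟩
  obtain ⟨p, hp, hlen, hmin⟩ := hU.exists_shortest a Aux.empty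
  obtain ⟨v, w, rfl, hv⟩ := hU.1.exists_minTotal_prefix hp
  obtain ⟨t, ht⟩ := hst.exists_leastTotalAt hv.1
  obtain ⟨hwt, hlab⟩ := hst.labels_of_shortest hU.1 ht.1 hp hmin
  obtain ⟨u, huw, hu, hu'⟩ := exists_cylinder hwt hlab
  have hut := huw.trans hwt
  obtain ⟨v', hv', hlen', -⟩ :=
    hU.exists_shortest (Nat.bits (Encodable.encode (prunedList st v t))) Aux.empty
  set Q := weightsOf (prunedList st v t) with hQ
  obtain ⟨n, hn⟩ : ∃ n, v.length = n := ⟨_, rfl⟩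
  have hlow : ((2 : ℚ≥0) ^ u.length)⁻¹ ≤ Q a := le_prunedList_apply hut hu
  have hpos : 0 < Q a := lt_of_lt_of_le (by positivity) hlow
  have hone : Q a ≤ 1 := by
    simpa using prunedList_apply_le (st := st) (v := v) (u := []) (a := a) (t := t)
      (Nat.zero_le _) (fun s _ _ => List.nil_prefix)
  have hlowR : ((2 : ℝ) ^ u.length)⁻¹ ≤ ((Q a : ℚ≥0) : ℝ) := by
    have := NNRat.cast_mono (K := ℝ) hlow
    push_cast at this
    exact this
  have hposR : (0 : ℝ) < ((Q a : ℚ≥0) : ℝ) := by exact_mod_cast hpos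
  have honeR : ((Q a : ℚ≥0) : ℝ) ≤ 1 := by exact_mod_cast hone
  have hlogpow : Real.logb 2 ((2 : ℝ) ^ u.length)⁻¹ = -(u.length : ℝ) := by
    rw [Real.logb_inv, Real.logb_pow, Real.logb_self_eq_one one_lt_two, mul_one]
  have hlognp : Real.logb 2 ((Q a : ℚ≥0) : ℝ) ≤ 0 :=
    Real.logb_nonpos one_lt_two hposR.le honeR
  have habs : |Real.logb 2 ((Q a : ℚ≥0) : ℝ)| ≤ u.length := by
    rw [abs_of_nonpos hlognp]
    have := Real.logb_le_logb_of_le one_lt_two (by positivity) hlowR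
    rw [hlogpow] at this
    linarith
  have hfloor : ⌊|Real.logb 2 ((Q a : ℚ≥0) : ℝ)|⌋ ≤ (u.length : ℤ) := by
    have := Int.floor_le_floor habs
    rwa [Int.floor_natCast] at this
  have hfloor0 : 0 ≤ ⌊|Real.logb 2 ((Q a : ℚ≥0) : ℝ)|⌋ := Int.floor_nonneg.2 (abs_nonneg _)
  have hfloor' : a ≠ [] → ⌊|Real.logb 2 ((Q a : ℚ≥0) : ℝ)|⌋ = (u.length : ℤ) := by
    intro ha
    have h1 : Q a = ((2 : ℚ≥0) ^ u.length)⁻¹ :=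
      le_antisymm (prunedList_apply_le hut (hu' ha)) hlow
    have h2 : ((Q a : ℚ≥0) : ℝ) = ((2 : ℝ) ^ u.length)⁻¹ := by
      rw [h1]
      push_cast
      rfl
    rw [h2, hlogpow, abs_neg, abs_of_nonneg (Nat.cast_nonneg _), Int.floor_natCast]
  have hKv' : v'.length ≤ n + 2 * Nat.size n + 1 + c₁ := by
    have h1 : (U.K (Nat.bits (Encodable.encode (prunedList st v t))) Aux.empty).toNat ≤ _ :=
      hc₁ v t ht
    rw [length_code, hn] at h1
    omega
  have hsize : Nat.size v'.length ≤ Nat.size n + (4 + c₁) := by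
    rw [Nat.size_le]
    have h1 : Nat.size n ≤ n := Nat.size_le.2 Nat.lt_two_pow_self
    have h2 : n < 2 ^ Nat.size n := Nat.lt_size_self n
    have h3 : 4 + c₁ < 2 ^ (4 + c₁) := Nat.lt_two_pow_self
    calc v'.length ≤ 3 * n + 1 + c₁ := by omega
      _ < 2 ^ Nat.size n * (4 + c₁) := by nlinarith
      _ ≤ 2 ^ Nat.size n * 2 ^ (4 + c₁) := Nat.mul_le_mul_left _ h3.le
      _ = 2 ^ (Nat.size n + (4 + c₁)) := (pow_add _ _ _).symm
  have hKa := hc₂ v' a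
  rw [length_code] at hKa
  have hKH := hc₅ v w a hv hp
  rw [length_code, hn] at hKH
  rw [List.length_append, hn] at hlen
  refine ⟨v', Q, n, ⟨⟨_, hv', rfl⟩, isProb_prunedList v t, hpos⟩, by omega, ?_, ?_, ?_⟩
  · rw [Machine.nonrandomness]
    -- For the empty string pruning may raise the weight above that of its cylinder, but its
    -- complexity is bounded by a constant relative to any input.
    by_cases ha : a = []
    · have := hc₄ (Aux.str v')
      subst ha
      omega
    · have := hc₃ v' u a _ _ hv' hut hu
      have := hfloor' ha
      omega
  -- The floor is at most `‖u‖ ≤ ‖w‖ = K(a) - n`, and `hKa` bounds `K(a)` through `v'`. Two of the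
  -- four `Nat.size n` come from the length of `v'` and two from the code of that length.
  · rw [Machine.nonrandomness]
    omega
  · rw [Machine.infoHalting]
    omega

/-! ### Growth estimates and the conclusion -/

/-- A function that is `O(n)` at `+∞` grows at most linearly above any bound from below. -/
theorem Asymptotics.IsBigO.exists_le_linear {f : ℤ → ℝ}
    (hf : f =O[atTop] (fun n : ℤ => (n : ℝ))) (c : ℕ) :
    ∃ A : ℝ, 0 ≤ A ∧ ∀ (d : ℤ) (s : ℕ), -(c : ℤ) ≤ d → d ≤ 4 * (s : ℤ) + c →
      f d ≤ A * (s + 1) := by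
  obtain ⟨b, hb, hf⟩ := hf.exists_pos
  obtain ⟨N, hN⟩ := eventually_atTop.1 hf.bound
  -- The hypothesis on `f` says nothing below `N`, but only finitely many integers from `-c` to `N`
  -- can occur.
  set M := ∑ d ∈ Finset.Icc (-(c : ℤ)) N, |f d| with hM
  have hM0 : 0 ≤ M := Finset.sum_nonneg fun _ _ => abs_nonneg _
  refine ⟨M + b * (4 + c), by positivity, fun d s h1 h2 => ?_⟩
  have hs : (0 : ℝ) ≤ s := Nat.cast_nonneg s
  rcases le_total d N with h | h
  · have h3 : |f d| ≤ M := Finset.single_le_sum (f := fun d => |f d|)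
      (fun _ _ => abs_nonneg _) (Finset.mem_Icc.2 ⟨h1, h⟩)
    calc f d ≤ M := (le_abs_self _).trans h3
      _ ≤ (M + b * (4 + c)) * 1 := by rw [mul_one]; exact le_add_of_nonneg_right (by positivity)
      _ ≤ _ := by gcongr; linarith
  · have h3 := hN d h
    rw [Real.norm_eq_abs, Real.norm_eq_abs] at h3
    have h4 : |(d : ℝ)| ≤ 4 * s + c := by
      rw [abs_le]
      constructor
      · have : -(c : ℝ) ≤ d := by exact_mod_cast h1
        linarith
      · exact_mod_cast h2
    calc f d ≤ b * |(d : ℝ)| := (le_abs_self _).trans h3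
      _ ≤ b * (4 * s + c) := by gcongr
      _ ≤ b * ((4 + c) * (s + 1)) := by
        gcongr
        nlinarith [mul_nonneg (Nat.cast_nonneg (α := ℝ) c) hs]
      _ ≤ _ := by nlinarith [mul_nonneg hM0 (add_nonneg hs zero_le_one)]

theorem Nat.four_mul_size_le (n : ℕ) : 4 * Nat.size n ≤ n + 40 := by
  have h : Nat.size n ≤ n / 4 + 10 := by
    rw [Nat.size_le, pow_add]
    have : n / 4 < 2 ^ (n / 4) := Nat.lt_two_pow_self
    omega
  omega

/-- From `n ≤ 2 * r` one gets `n < 2 * (max r 0 + 1)`; the factor `2` accounts for the extra `1`. -/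
theorem AlgInfo.size_le_lnorm {n : ℕ} {r : ℝ} (h : (n : ℝ) / 2 ≤ r) :
    Nat.size n ≤ lnorm (max r 0 + 1) + 1 := by
  have hpos : (0 : ℝ) < max r 0 + 1 := by positivity
  have h1 : Real.logb 2 (max r 0 + 1) ≤ lnorm (max r 0 + 1) :=
    (le_abs_self _).trans (Nat.le_ceil _)
  rw [Real.logb_le_iff_le_rpow one_lt_two hpos, Real.rpow_natCast] at h1
  rw [Nat.size_le]
  have h2 : (n : ℝ) < 2 ^ (lnorm (max r 0 + 1) + 1) := by
    rw [pow_succ]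
    linarith [le_max_left r 0]
  exact_mod_cast h2

theorem proposition1 (U : AlgInfo.Machine) (hU : U.IsUniversal) (hleft : U.IsLeftTotal)
    (f : ℤ → ℝ) (hf : f =O[atTop] (fun n : ℤ => (n : ℝ))) :
    ∃ C : ℝ, ∀ a : AlgInfo.Str,
      U.chi f a <
        (((U.infoHalting a : ℝ) +
          C * ((AlgInfo.lnorm (max (U.chi f a).toReal 0 + 1) : ℝ) + 1) : ℝ) : EReal) := by
  obtain ⟨c, hc⟩ := hU.exists_distribution hleft
  obtain ⟨A, hA, hfA⟩ := hf.exists_le_linear c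
  -- The second case below needs `2 * A + 2 * c + 4`, up to strictness; the first needs `c + 20`,
  -- where `20` is half of the `40` in `Nat.four_mul_size_le`.
  refine ⟨2 * A + 2 * c + 25, fun a => ?_⟩
  obtain ⟨v, Q, n, hQ, hv, hd, hd', hI⟩ := hc a
  have hchi : U.chi f a ≤ (((v.length : ℝ) + f (U.nonrandomness a Q v) : ℝ) : EReal) :=
    iInf_le_of_le v (iInf_le_of_le Q (iInf_le _ hQ))
  have hfd := hfA _ _ hd hd'
  generalize U.chi f a = χ at hchi ⊢
  induction χ with
  -- Nothing bounds `f` from below, so the infimum may be `-∞`, and the inequality is then trivial.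
  | bot => exact EReal.bot_lt_coe _
  | top => exact absurd (top_le_iff.1 hchi) (EReal.coe_ne_top _)
  | coe r =>
    rw [EReal.coe_le_coe_iff] at hchi
    rw [EReal.coe_lt_coe_iff, EReal.toReal_coe]
    have hvR : (v.length : ℝ) ≤ n + 2 * Nat.size n + c := by exact_mod_cast hv
    have hIR : (n : ℝ) - 2 * Nat.size n - c ≤ U.infoHalting a := by exact_mod_cast hI
    set L : ℝ := (AlgInfo.lnorm (max r 0 + 1) : ℝ) with hL
    have hL0 : 0 ≤ L := Nat.cast_nonneg _
    have hc0 : (0 : ℝ) ≤ c := Nat.cast_nonneg _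
    -- For `r < n / 2` the information is at least `n / 2 - 20 - c`, which suffices. Otherwise
    -- `Nat.size n` is at most `L + 1`, and the logarithmic terms are absorbed by the correction.
    rcases lt_or_ge r ((n : ℝ) / 2) with h | h
    · have h4 : 4 * (Nat.size n : ℝ) ≤ n + 40 := by exact_mod_cast Nat.four_mul_size_le n
      nlinarith [mul_nonneg hA hL0, mul_nonneg hc0 hL0]
    · have hs : (Nat.size n : ℝ) ≤ L + 1 := by
        rw [hL]
        exact_mod_cast AlgInfo.size_le_lnorm h
      nlinarith [mul_nonneg hA hL0, mul_nonneg hc0 hL0, mul_nonneg hA (sub_nonneg.2 hs)]
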